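/- Let $k_1,k_2,k_3,k_4,\gamma>0$ with $k_2\neq k_3$. Consider on $\mathbb{R}$ the laminated Timoshenko system with heat conduction given by Fourier's law acting on the first (transversal displacement) equation, $$ \begin{cases} \varphi_{tt}-k_1(\varphi_x+\psi+w)_x+\gamma\eta_x=0,\\ \psi_{tt}-k_2\psi_{xx}+k_1(\varphi_x+\psi+w)=0,\\ w_{tt}-k_3w_{xx}+k_1(\varphi_x+\psi+w)=0,\\ \eta_t-k_4\eta_{xx}+\gamma\varphi_{xt}=0, \end{cases} $$ written as a first-order system in time for $U=(v,u,z,y,\phi,\theta,\eta)^T$, where $v=\varphi_x+\psi+w$, $u=\varphi_t$, $z=\psi_x$, $y=\psi_t$, $\phi=w_x$, $\theta=w_t$: $$ \begin{cases} v_t-u_x-y-\theta=0,\\ u_t-k_1v_x+\gamma\eta_x=0,\\ z_t-y_x=0,\\ y_t-k_2z_x+k_1v=0,\\ \phi_t-\theta_x=0,\\ \theta_t-k_3\phi_x+k_1v=0,\\ \eta_t-k_4\eta_{xx}+\gamma u_x=0, \end{cases} \qquad U(\cdot,0)=U_0 . $$ Let $N,\ell\geq 1$ be integers with $\ell\leq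 N$ and let $j\in\{0,\dots,N-\ell\}$. Then there is a constant $c_0>0$, depending only on $k_1,k_2,k_3,k_4,\gamma,N,\ell,j$, such that for every $U_0\in H^N(\mathbb{R})\cap L^1(\mathbb{R})$ (with values in $\mathbb{C}^7$), the solution $U\in C([0,\infty);L^2(\mathbb{R}))$ of this first-order system with initial value $U_0$, the equations holding in the sense of tempered distributions in $x$ for every $t>0$, satisfies $\partial_x^jU(\cdot,t)\in L^2(\mathbb{R})$ and $$ \|\partial_x^jU(\cdot,t)\|_{L^2(\mathbb{R})}\leq c_0(1+t)^{-\frac1{12}-\frac j6}\,\|U_0\|_{L^1(\mathbb{R})}+c_0(1+t)^{-\frac{\ell}{2}}\,\|\partial_x^{j+\ell}U_0\|_{L^2(\mathbb{R})}\qquad\text{for all }t\geq 0 . $$ -/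

import Mathlib

open MeasureTheory TemperedDistribution
open scoped SchwartzMap LineDeriv

noncomputable section

namespace Laminated

/-- The pointwise values `(v, u, z, y, ϕ, θ, η)` of the unknown, with the Euclidean norm. -/
abbrev State : Type := EuclideanSpace ℂ (Fin 7)

/-- The space `L²(ℝ)` of square-integrable functions of `x` with values `(v, u, z, y, ϕ, θ, η)`. -/
abbrev L2 : Type := Lp State 2 (volume : Measure ℝ)

/-- The (weak) derivative `∂ₓ` on tempered distributions of the space variable `x ∈ ℝ`. -/
def dx (T : 𝓢'(ℝ, State)) : 𝓢'(ℝ, State) := ∂_{(1 : ℝ)} T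

/-- `A₂ X`; only the heat equation has a second-order term. -/
def A₂ (k₄ : ℝ) (X : State) : State :=
  !₂[0, 0, 0, 0, 0, 0, -(k₄ : ℂ) * X 6]

/-- `A₁ X`, the first-order terms. -/
def A₁ (k₁ k₂ k₃ γ τ₁ τ₂ τ₃ : ℝ) (X : State) : State :=
  !₂[-X 1,
    -(k₁ : ℂ) * X 0 + τ₁ * γ * X 6,
    -X 3,
    -(k₂ : ℂ) * X 2 + τ₂ * γ * X 6,
    -X 5,
    -(k₃ : ℂ) * X 4 + τ₃ * γ * X 6,
    γ * (τ₁ * X 1 + τ₂ * X 3 + τ₃ * X 5)]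

/-- `A₀ X`, the zero-order terms. -/
def A₀ (k₁ : ℝ) (X : State) : State :=
  !₂[-X 3 - X 5, 0, 0, k₁ * X 0, 0, k₁ * X 0, 0]

/-- `U` is a (weak) solution in `C([0, ∞); L²(ℝ))` of
`U_t + A₂ U_xx + A₁ U_x + A₀ U = 0` for `t > 0`, with `U(0) = U₀`.
The space derivatives are those of tempered distributions, and the equation holds in the sense of
tempered distributions at every time `t > 0`: it holds after pairing with every Schwartz function
`g` of `x`. (The matrices `A₂`, `A₁`, `A₀` are constant, so they commute with the pairing.)
The values of `U` at negative times play no role. -/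
structure IsSolution (k₁ k₂ k₃ k₄ γ τ₁ τ₂ τ₃ : ℝ) (U₀ : L2) (U : ℝ → L2) : Prop where
  continuousOn : ContinuousOn U (Set.Ici 0)
  initial : U 0 = U₀
  equation : ∀ t : ℝ, 0 < t → ∀ g : 𝓢(ℝ, ℂ),
    HasDerivAt (fun s : ℝ => (U s : 𝓢'(ℝ, State)) g)
      (-(A₂ k₄ (dx (dx (U t : 𝓢'(ℝ, State))) g)
        + A₁ k₁ k₂ k₃ γ τ₁ τ₂ τ₃ (dx (U t : 𝓢'(ℝ, State)) g)
        + A₀ k₁ ((U t : 𝓢'(ℝ, State)) g))) t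

end Laminated

end

set_option linter.unusedSimpArgs false

noncomputable section

namespace Laminated

/-! ### The Fourier symbol -/

/-! After a Fourier transform the system is an ODE in time for each frequency `ω`, and the theorem
reduces to a pointwise bound `|Û(t)|² ≤ C exp(-a ρ(ω) t) |Û₀|²` with `ρ(ω) = ω⁶ / (1 + ω²)⁴`
(`exists_fourier_decay`).

The natural energy dissipates only `η`. The other components are recovered one at a time along `η →
u → v → s → q → p → r`, where `s = y + θ`, `q = k₂ z + k₃ ϕ`, `p = k₂ y + k₃ θ`, `r = k₂² z + k₃²
ϕ`. Each link has a quadratic form whose derivative contains minus the square of the new variable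
plus products to be absorbed. Adding these forms to the energy with frequency weights and rapidly
decreasing powers of a small `δ` gives a Lyapunov functional (`exists_lyapunov`). The pairs `(s, p)`
and `(q, r)` determine `(y, θ)` and `(z, ϕ)` exactly because `k₂ ≠ k₃`.

A solution satisfies the equation only weakly and the symbol is unbounded, so the functional is not
differentiated pointwise. Multiplication by `(1 + ω²)⁻¹` turns the solution into a differentiable
curve in `L²` (`IsWeakFourierSolution.hasDerivAt_wOp`). Its Lyapunov functional is integrated over
sets of frequencies where `ρ` is bounded below, and varying these sets gives the pointwise bound.

The two terms of the estimate are the two regimes of `ρ` (`exp_rate_le`). For `|ω| ≤ 1`, `ρ` is at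
least `ω⁶ / 16`; `Û₀` is bounded by the `L¹` norm and a Gamma integral gives the rate. For `|ω| ≥
1`, `ρ` is only at least `1 / (16 ω²)`, so each power of `(1 + t)⁻¹` in the squared norm costs one
derivative of the data. -/

/-- `A₂` as a continuous linear map. -/
def A₂L (k₄ : ℝ) : State →L[ℂ] State := LinearMap.toContinuousLinearMap
  { toFun := A₂ k₄
    map_add' := fun X Y => by ext i; fin_cases i <;> simp [A₂] ; ring
    map_smul' := fun c X => by ext i; fin_cases i <;> simp [A₂]; ring }

/-- `A₁` for the coupling `τ = (1, 0, 0)`, as a continuous linear map. -/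
def A₁L (k₁ k₂ k₃ γ : ℝ) : State →L[ℂ] State := LinearMap.toContinuousLinearMap
  { toFun := A₁ k₁ k₂ k₃ γ 1 0 0
    map_add' := fun X Y => by ext i; fin_cases i <;> simp [A₁] <;> ring
    map_smul' := fun c X => by ext i; fin_cases i <;> simp [A₁] <;> ring }

/-- `A₀` as a continuous linear map. -/
def A₀L (k₁ : ℝ) : State →L[ℂ] State := LinearMap.toContinuousLinearMap
  { toFun := A₀ k₁
    map_add' := fun X Y => by ext i; fin_cases i <;> simp [A₀] <;> ring
    map_smul' := fun c X => by ext i; fin_cases i <;> simp [A₀] <;> ring }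

@[simp] lemma A₂L_apply (k₄ : ℝ) (X : State) : A₂L k₄ X = A₂ k₄ X := rfl
@[simp] lemma A₁L_apply (k₁ k₂ k₃ γ : ℝ) (X : State) :
    A₁L k₁ k₂ k₃ γ X = A₁ k₁ k₂ k₃ γ 1 0 0 X := rfl
@[simp] lemma A₀L_apply (k₁ : ℝ) (X : State) : A₀L k₁ X = A₀ k₁ X := rfl

/-- The symbol of the spatial operator `-(A₂ ∂ₓ² + A₁ ∂ₓ + A₀)` at the frequency `ω`. -/
def symbol (k₁ k₂ k₃ k₄ γ : ℝ) (ω : ℝ) : State →L[ℂ] State :=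
  ((ω : ℂ) ^ 2) • A₂L k₄ - (Complex.I * ω) • A₁L k₁ k₂ k₃ γ - A₀L k₁

section symbol

variable (k₁ k₂ k₃ k₄ γ ω : ℝ) (X : State)

lemma symbol_v : symbol k₁ k₂ k₃ k₄ γ ω X 0 = Complex.I * ω * X 1 + X 3 + X 5 := by
  simp [symbol, A₂, A₁, A₀]; ring
lemma symbol_u : symbol k₁ k₂ k₃ k₄ γ ω X 1 =
    Complex.I * ω * k₁ * X 0 - Complex.I * ω * γ * X 6 := by
  simp [symbol, A₂, A₁, A₀]; ring
lemma symbol_z : symbol k₁ k₂ k₃ k₄ γ ω X 2 = Complex.I * ω * X 3 := by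
  simp [symbol, A₂, A₁, A₀]
lemma symbol_y : symbol k₁ k₂ k₃ k₄ γ ω X 3 = Complex.I * ω * k₂ * X 2 - k₁ * X 0 := by
  simp [symbol, A₂, A₁, A₀]; ring
lemma symbol_φ : symbol k₁ k₂ k₃ k₄ γ ω X 4 = Complex.I * ω * X 5 := by
  simp [symbol, A₂, A₁, A₀]
lemma symbol_θ : symbol k₁ k₂ k₃ k₄ γ ω X 5 = Complex.I * ω * k₃ * X 4 - k₁ * X 0 := by
  simp [symbol, A₂, A₁, A₀]; ring
lemma symbol_η : symbol k₁ k₂ k₃ k₄ γ ω X 6 =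
    -(k₄ * ω ^ 2 * X 6) - Complex.I * ω * γ * X 1 := by
  simp [symbol, A₂, A₁, A₀]; ring

end symbol

/-! ### The quadratic forms of the Lyapunov functional -/

/-- The weight of the energy. -/
def energyForm (k₁ k₂ k₃ : ℝ) : State →L[ℂ] State := LinearMap.toContinuousLinearMap
  { toFun := fun X => !₂[k₁ * X 0, X 1, k₂ * X 2, X 3, k₃ * X 4, X 5, X 6]
    map_add' := fun X Y => by ext i; fin_cases i <;> simp <;> ring
    map_smul' := fun c X => by ext i; fin_cases i <;> simp <;> ring }

/-- The form `Re (i u η̄)`. -/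
def formUη : State →L[ℂ] State := LinearMap.toContinuousLinearMap
  { toFun := fun X => !₂[0, 0, 0, 0, 0, 0, Complex.I * X 1]
    map_add' := fun X Y => by ext i; fin_cases i <;> simp <;> ring
    map_smul' := fun c X => by ext i; fin_cases i <;> simp <;> ring }

/-- The form `Re (i u v̄)`. -/
def formUV : State →L[ℂ] State := LinearMap.toContinuousLinearMap
  { toFun := fun X => !₂[Complex.I * X 1, 0, 0, 0, 0, 0, 0]
    map_add' := fun X Y => by ext i; fin_cases i <;> simp <;> ring
    map_smul' := fun c X => by ext i; fin_cases i <;> simp <;> ring }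

/-- The form `-Re (v s̄)` with `s = y + θ`. -/
def formVS : State →L[ℂ] State := LinearMap.toContinuousLinearMap
  { toFun := fun X => !₂[0, 0, 0, -X 0, 0, -X 0, 0]
    map_add' := fun X Y => by ext i; fin_cases i <;> simp <;> ring
    map_smul' := fun c X => by ext i; fin_cases i <;> simp }

/-- The form `Re ((i ω s + 2 u) q̄)` with `s = y + θ`, `q = k₂ z + k₃ ϕ`; here `a = ω` and `b = 1`. -/
def formSQ (k₂ k₃ a b : ℝ) : State →L[ℂ] State := LinearMap.toContinuousLinearMap
  { toFun := fun X => !₂[0, 0, k₂ * (a * Complex.I * (X 3 + X 5) + b * 2 * X 1), 0,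
      k₃ * (a * Complex.I * (X 3 + X 5) + b * 2 * X 1), 0, 0]
    map_add' := fun X Y => by ext i; fin_cases i <;> simp <;> ring
    map_smul' := fun c X => by ext i; fin_cases i <;> simp <;> ring }

/-- The form `ω Re (i q p̄) - (k₂ + k₃) Re (u q̄)` with `q = k₂ z + k₃ ϕ`, `p = k₂ y + k₃ θ`. -/
def formQP (k₂ k₃ a b : ℝ) : State →L[ℂ] State := LinearMap.toContinuousLinearMap
  { toFun := fun X => !₂[0, 0, -(k₂ * (b * (k₂ + k₃) * X 1)),
      k₂ * (a * Complex.I * (k₂ * X 2 + k₃ * X 4)), -(k₃ * (b * (k₂ + k₃) * X 1)),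
      k₃ * (a * Complex.I * (k₂ * X 2 + k₃ * X 4)), 0]
    map_add' := fun X Y => by ext i; fin_cases i <;> simp <;> ring
    map_smul' := fun c X => by ext i; fin_cases i <;> simp <;> ring }

/-- The form `Re ((i ω p + (k₂ + k₃) u) r̄)` with `p = k₂ y + k₃ θ`, `r = k₂² z + k₃² ϕ`. -/
def formPR (k₂ k₃ a b : ℝ) : State →L[ℂ] State := LinearMap.toContinuousLinearMap
  { toFun := fun X =>
      !₂[0, 0, k₂ ^ 2 * (a * Complex.I * (k₂ * X 3 + k₃ * X 5) + b * (k₂ + k₃) * X 1), 0,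
        k₃ ^ 2 * (a * Complex.I * (k₂ * X 3 + k₃ * X 5) + b * (k₂ + k₃) * X 1), 0, 0]
    map_add' := fun X Y => by ext i; fin_cases i <;> simp <;> ring
    map_smul' := fun c X => by ext i; fin_cases i <;> simp <;> ring }

/-- The derivative along `X' = M X` of the form `Re ⟪X, T X⟫`. -/
def formDeriv (M T : State →L[ℂ] State) (X : State) : ℝ :=
  (inner ℂ (M X) (T X)).re + (inner ℂ X (T (M X))).re

lemma formDeriv_add (M T T' : State →L[ℂ] State) (X : State) :
    formDeriv M (T + T') X = formDeriv M T X + formDeriv M T' X := by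
  simp [formDeriv]; ring

lemma formDeriv_smul (M T : State →L[ℂ] State) (a : ℝ) (X : State) :
    formDeriv M (a • T) X = a * formDeriv M T X := by
  have h : ∀ x y : State, (inner ℂ x (a • y)).re = a * (inner ℂ x y).re := by
    intro x y
    rw [inner_smul_right_eq_smul]; simp
  simp only [formDeriv, smul_apply, h]; ring

lemma mul_re_le (a : ℝ) (x y : ℂ) : a * (x * star y).re ≤ |a| * (‖x‖ * ‖y‖) := by
  have h := Complex.abs_re_le_norm (x * star y)
  rw [norm_mul, norm_star] at h
  calc _ ≤ |a * (x * star y).re| := le_abs_self _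
    _ = |a| * |(x * star y).re| := abs_mul _ _
    _ ≤ _ := by gcongr

lemma mul_re_I_le (a : ℝ) (x y : ℂ) : a * (Complex.I * x * star y).re ≤ |a| * (‖x‖ * ‖y‖) := by
  simpa using mul_re_le a (Complex.I * x) y

section derivatives

variable (k₁ k₂ k₃ k₄ γ ω : ℝ) (X : State)

/-- The first-order and zero-order couplings are skew for the energy weight and cancel; only heat
diffusion remains. -/
lemma formDeriv_energyForm :
    formDeriv (symbol k₁ k₂ k₃ k₄ γ ω) (energyForm k₁ k₂ k₃) X = -(2 * k₄ * ω ^ 2 * ‖X 6‖ ^ 2) := by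
  simp only [formDeriv, PiLp.inner_apply, Fin.sum_univ_seven, energyForm, symbol_v, symbol_u,
    symbol_z, symbol_y, symbol_φ, symbol_θ, symbol_η, RCLike.inner_apply, ← Complex.normSq_eq_norm_sq,
    Complex.normSq_apply]
  simp [-Complex.inner, pow_two, symbol_v, symbol_u, symbol_z, symbol_y, symbol_φ, symbol_θ, symbol_η]
  ring

lemma formDeriv_formUη (hk₁ : 0 ≤ k₁) (hk₄ : 0 ≤ k₄) :
    formDeriv (symbol k₁ k₂ k₃ k₄ γ ω) (ω • formUη) X ≤
      -(γ * ω ^ 2 * ‖X 1‖ ^ 2) + γ * ω ^ 2 * ‖X 6‖ ^ 2 + k₁ * ω ^ 2 * (‖X 0‖ * ‖X 6‖)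
        + k₄ * |ω| ^ 3 * (‖X 1‖ * ‖X 6‖) := by
  have h : formDeriv (symbol k₁ k₂ k₃ k₄ γ ω) (ω • formUη) X =
      -(γ * ω ^ 2 * ‖X 1‖ ^ 2) + γ * ω ^ 2 * ‖X 6‖ ^ 2
        + (-(k₁ * ω ^ 2)) * (X 0 * star (X 6)).re
        + (-(k₄ * ω ^ 3)) * (Complex.I * X 1 * star (X 6)).re := by
    simp only [formDeriv, PiLp.inner_apply, Fin.sum_univ_seven, formUη, symbol_v, symbol_u,
      symbol_z, symbol_y, symbol_φ, symbol_θ, symbol_η, RCLike.inner_apply,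
      ← Complex.normSq_eq_norm_sq, Complex.normSq_apply]
    simp [-Complex.inner, pow_two, symbol_v, symbol_u, symbol_z, symbol_y, symbol_φ, symbol_θ, symbol_η]
    ring
  have h1 := mul_re_le (-(k₁ * ω ^ 2)) (X 0) (X 6)
  have h2 := mul_re_I_le (-(k₄ * ω ^ 3)) (X 1) (X 6)
  rw [abs_neg, abs_mul, abs_of_nonneg hk₁, abs_pow, sq_abs] at h1
  rw [abs_neg, abs_mul, abs_of_nonneg hk₄, abs_pow] at h2
  linarith

lemma formDeriv_formUV (hγ : 0 ≤ γ) :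
    formDeriv (symbol k₁ k₂ k₃ k₄ γ ω) (ω • formUV) X ≤
      -(k₁ * ω ^ 2 * ‖X 0‖ ^ 2) + ω ^ 2 * ‖X 1‖ ^ 2 + γ * ω ^ 2 * (‖X 6‖ * ‖X 0‖)
        + |ω| * (‖X 1‖ * ‖X 3 + X 5‖) := by
  have h : formDeriv (symbol k₁ k₂ k₃ k₄ γ ω) (ω • formUV) X =
      -(k₁ * ω ^ 2 * ‖X 0‖ ^ 2) + ω ^ 2 * ‖X 1‖ ^ 2
        + (γ * ω ^ 2) * (X 6 * star (X 0)).re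
        + ω * (Complex.I * X 1 * star (X 3 + X 5)).re := by
    simp only [formDeriv, PiLp.inner_apply, Fin.sum_univ_seven, formUV, symbol_v, symbol_u,
      symbol_z, symbol_y, symbol_φ, symbol_θ, symbol_η, RCLike.inner_apply,
      ← Complex.normSq_eq_norm_sq, Complex.normSq_apply]
    simp [-Complex.inner, pow_two, symbol_v, symbol_u, symbol_z, symbol_y, symbol_φ, symbol_θ, symbol_η]
    ring
  have h1 := mul_re_le (γ * ω ^ 2) (X 6) (X 0)
  have h2 := mul_re_I_le ω (X 1) (X 3 + X 5)
  rw [abs_mul, abs_of_nonneg hγ, abs_pow, sq_abs] at h1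
  linarith

lemma formDeriv_formVS :
    formDeriv (symbol k₁ k₂ k₃ k₄ γ ω) formVS X ≤
      -(‖X 3 + X 5‖ ^ 2) + 2 * k₁ * ‖X 0‖ ^ 2 + |ω| * (‖X 1‖ * ‖X 3 + X 5‖)
        + |ω| * (‖X 0‖ * ‖k₂ * X 2 + k₃ * X 4‖) := by
  have h : formDeriv (symbol k₁ k₂ k₃ k₄ γ ω) formVS X =
      -(‖X 3 + X 5‖ ^ 2) + 2 * k₁ * ‖X 0‖ ^ 2
        + (-ω) * (Complex.I * X 1 * star (X 3 + X 5)).re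
        + ω * (Complex.I * X 0 * star (k₂ * X 2 + k₃ * X 4)).re := by
    simp only [formDeriv, PiLp.inner_apply, Fin.sum_univ_seven, formVS, symbol_v, symbol_u,
      symbol_z, symbol_y, symbol_φ, symbol_θ, symbol_η, RCLike.inner_apply,
      ← Complex.normSq_eq_norm_sq, Complex.normSq_apply]
    simp [-Complex.inner, pow_two, symbol_v, symbol_u, symbol_z, symbol_y, symbol_φ, symbol_θ, symbol_η]
    ring
  have h1 := mul_re_I_le (-ω) (X 1) (X 3 + X 5)
  have h2 := mul_re_I_le ω (X 0) (k₂ * X 2 + k₃ * X 4)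
  rw [abs_neg] at h1
  linarith

/-- Along the flow `s' = iω q - 2 k₁ v` and `q' = iω p`. The correction `2 u` cancels the product of
`v` and `q`, which the chain weights could not absorb at low frequency, and trades it for products
of `η` with `q` and of `u` with `p`, which they can. -/
lemma formDeriv_formSQ (hγ : 0 ≤ γ) :
    formDeriv (symbol k₁ k₂ k₃ k₄ γ ω) (formSQ k₂ k₃ ω 1) X ≤
      -(ω ^ 2 * ‖k₂ * X 2 + k₃ * X 4‖ ^ 2) + ω ^ 2 * (‖X 3 + X 5‖ * ‖k₂ * X 3 + k₃ * X 5‖)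
        + 2 * γ * |ω| * (‖X 6‖ * ‖k₂ * X 2 + k₃ * X 4‖)
        + 2 * |ω| * (‖X 1‖ * ‖k₂ * X 3 + k₃ * X 5‖) := by
  have h : formDeriv (symbol k₁ k₂ k₃ k₄ γ ω) (formSQ k₂ k₃ ω 1) X =
      -(ω ^ 2 * ‖k₂ * X 2 + k₃ * X 4‖ ^ 2)
        + ω ^ 2 * ((X 3 + X 5) * star (k₂ * X 3 + k₃ * X 5)).re
        + (-(2 * γ * ω)) * (Complex.I * X 6 * star (k₂ * X 2 + k₃ * X 4)).re
        + (-(2 * ω)) * (Complex.I * X 1 * star (k₂ * X 3 + k₃ * X 5)).re := by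
    simp only [formDeriv, PiLp.inner_apply, Fin.sum_univ_seven, formSQ, symbol_v, symbol_u,
      symbol_z, symbol_y, symbol_φ, symbol_θ, symbol_η, RCLike.inner_apply,
      ← Complex.normSq_eq_norm_sq, Complex.normSq_apply]
    simp [-Complex.inner, pow_two, symbol_v, symbol_u, symbol_z, symbol_y, symbol_φ, symbol_θ, symbol_η]
    ring
  have h1 := mul_re_le (ω ^ 2) (X 3 + X 5) (k₂ * X 3 + k₃ * X 5)
  have h2 := mul_re_I_le (-(2 * γ * ω)) (X 6) (k₂ * X 2 + k₃ * X 4)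
  have h3 := mul_re_I_le (-(2 * ω)) (X 1) (k₂ * X 3 + k₃ * X 5)
  rw [abs_pow, sq_abs] at h1
  rw [abs_neg, abs_mul, abs_of_nonneg (by positivity)] at h2
  rw [abs_neg, abs_mul, abs_of_nonneg (by positivity)] at h3
  linarith

/-- Here `p' = iω r - k₁ (k₂ + k₃) v`, and the term in `u` again removes the product of `v` and `q`.
-/
lemma formDeriv_formQP (hk₂ : 0 ≤ k₂) (hk₃ : 0 ≤ k₃) (hγ : 0 ≤ γ) :
    formDeriv (symbol k₁ k₂ k₃ k₄ γ ω) (formQP k₂ k₃ ω 1) X ≤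
      -(ω ^ 2 * ‖k₂ * X 3 + k₃ * X 5‖ ^ 2)
        + ω ^ 2 * (‖k₂ * X 2 + k₃ * X 4‖ * ‖k₂ ^ 2 * X 2 + k₃ ^ 2 * X 4‖)
        + (k₂ + k₃) * γ * |ω| * (‖X 6‖ * ‖k₂ * X 2 + k₃ * X 4‖)
        + (k₂ + k₃) * |ω| * (‖X 1‖ * ‖k₂ * X 3 + k₃ * X 5‖) := by
  have h : formDeriv (symbol k₁ k₂ k₃ k₄ γ ω) (formQP k₂ k₃ ω 1) X =
      -(ω ^ 2 * ‖k₂ * X 3 + k₃ * X 5‖ ^ 2)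
        + ω ^ 2 * ((k₂ * X 2 + k₃ * X 4) * star (k₂ ^ 2 * X 2 + k₃ ^ 2 * X 4)).re
        + ((k₂ + k₃) * γ * ω) * (Complex.I * X 6 * star (k₂ * X 2 + k₃ * X 4)).re
        + ((k₂ + k₃) * ω) * (Complex.I * X 1 * star (k₂ * X 3 + k₃ * X 5)).re := by
    simp only [formDeriv, PiLp.inner_apply, Fin.sum_univ_seven, formQP, symbol_v, symbol_u,
      symbol_z, symbol_y, symbol_φ, symbol_θ, symbol_η, RCLike.inner_apply,
      ← Complex.normSq_eq_norm_sq, Complex.normSq_apply]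
    simp [-Complex.inner, pow_two, symbol_v, symbol_u, symbol_z, symbol_y, symbol_φ, symbol_θ, symbol_η]
    ring
  have h1 := mul_re_le (ω ^ 2) (k₂ * X 2 + k₃ * X 4) (k₂ ^ 2 * X 2 + k₃ ^ 2 * X 4)
  have h2 := mul_re_I_le ((k₂ + k₃) * γ * ω) (X 6) (k₂ * X 2 + k₃ * X 4)
  have h3 := mul_re_I_le ((k₂ + k₃) * ω) (X 1) (k₂ * X 3 + k₃ * X 5)
  rw [abs_pow, sq_abs] at h1
  rw [abs_mul, abs_of_nonneg (by positivity)] at h2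
  rw [abs_mul, abs_of_nonneg (by positivity)] at h3
  linarith

/-- The chain closes at `r`: both `k₂` and `k₃` are roots of `x² = (k₂ + k₃) x - k₂ k₃`, so `r' = iω
((k₂ + k₃) p - k₂ k₃ s)` involves no new variable. -/
lemma formDeriv_formPR (hk₂ : 0 ≤ k₂) (hk₃ : 0 ≤ k₃) (hγ : 0 ≤ γ) :
    formDeriv (symbol k₁ k₂ k₃ k₄ γ ω) (formPR k₂ k₃ ω 1) X ≤
      -(ω ^ 2 * ‖k₂ ^ 2 * X 2 + k₃ ^ 2 * X 4‖ ^ 2)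
        + (k₂ + k₃) * ω ^ 2 * ‖k₂ * X 3 + k₃ * X 5‖ ^ 2
        + k₂ * k₃ * ω ^ 2 * (‖X 3 + X 5‖ * ‖k₂ * X 3 + k₃ * X 5‖)
        + (k₂ + k₃) * γ * |ω| * (‖X 6‖ * ‖k₂ ^ 2 * X 2 + k₃ ^ 2 * X 4‖)
        + (k₂ + k₃) ^ 2 * |ω| * (‖X 1‖ * ‖k₂ * X 3 + k₃ * X 5‖)
        + (k₂ + k₃) * k₂ * k₃ * |ω| * (‖X 1‖ * ‖X 3 + X 5‖) := by
  have h : formDeriv (symbol k₁ k₂ k₃ k₄ γ ω) (formPR k₂ k₃ ω 1) X =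
      -(ω ^ 2 * ‖k₂ ^ 2 * X 2 + k₃ ^ 2 * X 4‖ ^ 2)
        + (k₂ + k₃) * ω ^ 2 * ‖k₂ * X 3 + k₃ * X 5‖ ^ 2
        + (-(k₂ * k₃ * ω ^ 2)) * ((X 3 + X 5) * star (k₂ * X 3 + k₃ * X 5)).re
        + (-((k₂ + k₃) * γ * ω)) * (Complex.I * X 6 * star (k₂ ^ 2 * X 2 + k₃ ^ 2 * X 4)).re
        + (-((k₂ + k₃) ^ 2 * ω)) * (Complex.I * X 1 * star (k₂ * X 3 + k₃ * X 5)).re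
        + ((k₂ + k₃) * k₂ * k₃ * ω) * (Complex.I * X 1 * star (X 3 + X 5)).re := by
    simp only [formDeriv, PiLp.inner_apply, Fin.sum_univ_seven, formPR, symbol_v, symbol_u,
      symbol_z, symbol_y, symbol_φ, symbol_θ, symbol_η, RCLike.inner_apply,
      ← Complex.normSq_eq_norm_sq, Complex.normSq_apply]
    simp [-Complex.inner, pow_two, symbol_v, symbol_u, symbol_z, symbol_y, symbol_φ, symbol_θ, symbol_η]
    ring
  have h1 := mul_re_le (-(k₂ * k₃ * ω ^ 2)) (X 3 + X 5) (k₂ * X 3 + k₃ * X 5)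
  have h2 := mul_re_I_le (-((k₂ + k₃) * γ * ω)) (X 6) (k₂ ^ 2 * X 2 + k₃ ^ 2 * X 4)
  have h3 := mul_re_I_le (-((k₂ + k₃) ^ 2 * ω)) (X 1) (k₂ * X 3 + k₃ * X 5)
  have h4 := mul_re_I_le ((k₂ + k₃) * k₂ * k₃ * ω) (X 1) (X 3 + X 5)
  rw [abs_neg, abs_mul, abs_of_nonneg (by positivity), abs_pow, sq_abs] at h1
  rw [abs_neg, abs_mul, abs_of_nonneg (by positivity)] at h2
  rw [abs_neg, abs_mul, abs_of_nonneg (by positivity)] at h3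
  rw [abs_mul, abs_of_nonneg (by positivity)] at h4
  linarith

end derivatives

/-! ### The Lyapunov functional -/

/-- Young's inequality for `δ ^ a * X` and `δ ^ b * Y`; the remaining power of `δ` is the smallness
used for absorption. -/
lemma pow_mul_mul_le_weighted {δ : ℝ} (h0 : 0 ≤ δ) (h1 : δ ≤ 1) {X Y : ℝ} (hX : 0 ≤ X) (hY : 0 ≤ Y)
    (m a b : ℕ) (h : a + b + 1 ≤ m) :
    δ ^ m * (X * Y) ≤ δ * (δ ^ (2 * a) * X ^ 2 + δ ^ (2 * b) * Y ^ 2) := by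
  have e1 : δ ^ m * (X * Y) ≤ δ ^ (a + b + 1) * (X * Y) :=
    mul_le_mul_of_nonneg_right (pow_le_pow_of_le_one h0 h1 h) (by positivity)
  have e2 : δ ^ (a + b + 1) * (X * Y) = δ * ((δ ^ a * X) * (δ ^ b * Y)) := by ring
  have e3 : (δ ^ a * X) * (δ ^ b * Y) ≤ δ ^ (2 * a) * X ^ 2 + δ ^ (2 * b) * Y ^ 2 := by
    have : δ ^ (2 * a) * X ^ 2 + δ ^ (2 * b) * Y ^ 2 = (δ ^ a * X) ^ 2 + (δ ^ b * Y) ^ 2 := by ring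
    nlinarith [sq_nonneg (δ ^ a * X - δ ^ b * Y), sq_nonneg (δ ^ a * X), sq_nonneg (δ ^ b * Y)]
  rw [e2] at e1
  exact e1.trans (mul_le_mul_of_nonneg_left e3 h0)

/-- Absorption along the chain `η → u → v → s → q → p → r`. -/
lemma chain_absorption {δ κ A h U V S Q P R D₀ D₁ D₂ D₃ D₄ D₅ D₆ : ℝ} (hδ : 0 ≤ δ) (hδ1 : δ ≤ 1)
    (hA : 0 ≤ A) (hh : 0 ≤ h) (hU : 0 ≤ U) (hV : 0 ≤ V) (hS : 0 ≤ S) (hQ : 0 ≤ Q)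
    (hP : 0 ≤ P) (hR : 0 ≤ R)
    (h₀ : D₀ ≤ -(κ * h ^ 2))
    (h₁ : D₁ ≤ -(κ * U ^ 2) + A * (h * h + h * V + h * U))
    (h₂ : D₂ ≤ -(κ * V ^ 2) + A * (h * V + U * U + U * S))
    (h₃ : D₃ ≤ -(κ * S ^ 2) + A * (V * V + U * S + V * Q))
    (h₄ : D₄ ≤ -(κ * Q ^ 2) + A * (S * P + h * Q + U * P))
    (h₅ : D₅ ≤ -(κ * P ^ 2) + A * (Q * R + h * Q + U * P))
    (h₆ : D₆ ≤ -(κ * R ^ 2) + A * (P * P + S * P + h * R + U * P + U * S)) :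
    D₀ + δ ^ 12 * D₁ + δ ^ 22 * D₂ + δ ^ 30 * D₃ + δ ^ 36 * D₄ + δ ^ 40 * D₅ + δ ^ 42 * D₆ ≤
      -((κ - 40 * A * δ) * (h ^ 2 + δ ^ 12 * U ^ 2 + δ ^ 22 * V ^ 2 + δ ^ 30 * S ^ 2
        + δ ^ 36 * Q ^ 2 + δ ^ 40 * P ^ 2 + δ ^ 42 * R ^ 2)) := by
  have k₁ := mul_le_mul_of_nonneg_left h₁ (pow_nonneg hδ 12)
  have k₂ := mul_le_mul_of_nonneg_left h₂ (pow_nonneg hδ 22)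
  have k₃ := mul_le_mul_of_nonneg_left h₃ (pow_nonneg hδ 30)
  have k₄ := mul_le_mul_of_nonneg_left h₄ (pow_nonneg hδ 36)
  have k₅ := mul_le_mul_of_nonneg_left h₅ (pow_nonneg hδ 40)
  have k₆ := mul_le_mul_of_nonneg_left h₆ (pow_nonneg hδ 42)
  have y : ∀ {X Y : ℝ} (m a b : ℕ), 0 ≤ X → 0 ≤ Y → a + b + 1 ≤ m →
      δ ^ m * (X * Y) ≤ δ * (δ ^ (2 * a) * X ^ 2 + δ ^ (2 * b) * Y ^ 2) :=
    fun m a b hX hY h => pow_mul_mul_le_weighted hδ hδ1 hX hY m a b h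
  -- In each line `2 a` and `2 b` are the exponents already attached to the two squares. The
  -- sequence 0, 12, 22, 30, 36, 40, 42 has second difference -2, so a product of the two neighbours
  -- of a link still has exactly one `δ` to spare.
  have a1 := y 12 0 0 hh hh (by norm_num)
  have a2 := y 12 0 11 hh hV (by norm_num)
  have a3 := y 12 0 6 hh hU (by norm_num)
  have b1 := y 22 0 11 hh hV (by norm_num)
  have b2 := y 22 6 6 hU hU (by norm_num)
  have b3 := y 22 6 15 hU hS (by norm_num)
  have c1 := y 30 11 11 hV hV (by norm_num)
  have c2 := y 30 6 15 hU hS (by norm_num)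
  have c3 := y 30 11 18 hV hQ (by norm_num)
  have d1 := y 36 15 20 hS hP (by norm_num)
  have d2 := y 36 0 18 hh hQ (by norm_num)
  have d3 := y 36 6 20 hU hP (by norm_num)
  have e1 := y 40 18 21 hQ hR (by norm_num)
  have e2 := y 40 0 18 hh hQ (by norm_num)
  have e3 := y 40 6 20 hU hP (by norm_num)
  have f1 := y 42 20 20 hP hP (by norm_num)
  have f2 := y 42 15 20 hS hP (by norm_num)
  have f3 := y 42 0 21 hh hR (by norm_num)
  have f4 := y 42 6 20 hU hP (by norm_num)
  have f5 := y 42 6 15 hU hS (by norm_num)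
  norm_num at a1 a2 a3 b1 b2 b3 c1 c2 c3 d1 d2 d3 e1 e2 e3 f1 f2 f3 f4 f5
  set T := h ^ 2 + δ ^ 12 * U ^ 2 + δ ^ 22 * V ^ 2 + δ ^ 30 * S ^ 2
        + δ ^ 36 * Q ^ 2 + δ ^ 40 * P ^ 2 + δ ^ 42 * R ^ 2 with hT
  -- Twenty products, each contributing at most twice to a given square, give the crude constant 40.
  have key : δ ^ 12 * (h * h + h * V + h * U) + δ ^ 22 * (h * V + U * U + U * S)
      + δ ^ 30 * (V * V + U * S + V * Q) + δ ^ 36 * (S * P + h * Q + U * P)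
      + δ ^ 40 * (Q * R + h * Q + U * P) + δ ^ 42 * (P * P + S * P + h * R + U * P + U * S)
      ≤ 40 * δ * T := by
    have t0 : 0 ≤ δ * h ^ 2 := by positivity
    have t1 : 0 ≤ δ * (δ ^ 12 * U ^ 2) := by positivity
    have t2 : 0 ≤ δ * (δ ^ 22 * V ^ 2) := by positivity
    have t3 : 0 ≤ δ * (δ ^ 30 * S ^ 2) := by positivity
    have t4 : 0 ≤ δ * (δ ^ 36 * Q ^ 2) := by positivity
    have t5 : 0 ≤ δ * (δ ^ 40 * P ^ 2) := by positivity
    have t6 : 0 ≤ δ * (δ ^ 42 * R ^ 2) := by positivity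
    rw [hT]
    linarith
  have key' := mul_le_mul_of_nonneg_left key hA
  rw [hT] at key' ⊢
  linarith

/-- The decay rate of the frequency `ω`. -/
def rate (ω : ℝ) : ℝ := ω ^ 6 / (1 + ω ^ 2) ^ 4

/-- The weight matrix of the Lyapunov functional, with hierarchy parameter `δ`. -/
def lyap (k₁ k₂ k₃ δ ω : ℝ) : State →L[ℂ] State :=
  energyForm k₁ k₂ k₃
    + (δ ^ 12 * (ω ^ 2 / (1 + ω ^ 2) ^ 2)) • (ω • formUη)
    + (δ ^ 22 * (ω ^ 4 / (1 + ω ^ 2) ^ 3)) • (ω • formUV)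
    + (δ ^ 30 * (ω ^ 6 / (1 + ω ^ 2) ^ 4)) • formVS
    + (δ ^ 36 * (ω ^ 4 / (1 + ω ^ 2) ^ 4)) • formSQ k₂ k₃ ω 1
    + (δ ^ 40 * (ω ^ 4 / (1 + ω ^ 2) ^ 4)) • formQP k₂ k₃ ω 1
    + (δ ^ 42 * (ω ^ 4 / (1 + ω ^ 2) ^ 4)) • formPR k₂ k₃ ω 1

section dissipation

variable {k₁ k₂ k₃ k₄ γ : ℝ}

set_option maxHeartbeats 4000000 in
/-- The dissipation of the Lyapunov functional in the variables of the chain. -/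
lemma exists_formDeriv_lyap_chain (hk₁ : 0 < k₁) (hk₂ : 0 < k₂) (hk₃ : 0 < k₃) (hk₄ : 0 < k₄)
    (hγ : 0 < γ) : ∃ κ A : ℝ, 0 < κ ∧ 0 < A ∧ ∀ δ : ℝ, 0 ≤ δ → δ ≤ 1 → ∀ (ω : ℝ) (X : State),
      ∃ h U V : ℝ, rate ω * ‖X 6‖ ^ 2 ≤ h ^ 2 ∧ rate ω * ‖X 1‖ ^ 2 ≤ U ^ 2 ∧
        rate ω * ‖X 0‖ ^ 2 ≤ V ^ 2 ∧
        formDeriv (symbol k₁ k₂ k₃ k₄ γ ω) (lyap k₁ k₂ k₃ δ ω) X ≤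
          -((κ - 40 * A * δ) * (h ^ 2 + δ ^ 12 * U ^ 2 + δ ^ 22 * V ^ 2
          + δ ^ 30 * (rate ω * ‖X 3 + X 5‖ ^ 2)
          + δ ^ 36 * (rate ω * ‖k₂ * X 2 + k₃ * X 4‖ ^ 2)
          + δ ^ 40 * (rate ω * ‖k₂ * X 3 + k₃ * X 5‖ ^ 2)
          + δ ^ 42 * (rate ω * ‖k₂ ^ 2 * X 2 + k₃ ^ 2 * X 4‖ ^ 2))) := by
  -- `A` dominates the coefficient of every product to be absorbed, and `κ` is a lower bound for the
  -- coefficients of the good squares.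
  set A : ℝ := 2 + γ + k₁ + k₄ + 2 * k₁ + 2 * γ + (k₂ + k₃) * γ + (k₂ + k₃) + k₂ * k₃
    + (k₂ + k₃) ^ 2 + (k₂ + k₃) * k₂ * k₃ with hA
  set κ : ℝ := min (min (2 * k₄) γ) (min k₁ 1) with hκ
  have hκ4 : κ ≤ 2 * k₄ := (min_le_left _ _).trans (min_le_left _ _)
  have hκγ : κ ≤ γ := (min_le_left _ _).trans (min_le_right _ _)
  have hκ1 : κ ≤ k₁ := (min_le_right _ _).trans (min_le_left _ _)
  have hκo : κ ≤ 1 := (min_le_right _ _).trans (min_le_right _ _)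
  have hA0 : 0 < A := by positivity
  refine ⟨κ, A, by positivity, hA0, fun δ hδ hδ1 ω X => ?_⟩
  -- With `w = |ω|` and `e = (1 + ω²)^(-1/2)` all frequency weights are monomials, and comparing
  -- them needs only `w e ≤ 1` and `e ≤ 1`.
  set w : ℝ := |ω| with hw
  set e : ℝ := (√(1 + ω ^ 2))⁻¹ with he
  have hw0 : 0 ≤ w := abs_nonneg ω
  have he0 : 0 ≤ e := by positivity
  have hww : ω ^ 2 = w ^ 2 := (sq_abs ω).symm
  have hee : (1 + ω ^ 2)⁻¹ = e ^ 2 := by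
    rw [he, inv_pow, Real.sq_sqrt (by positivity)]
  have he1 : e ≤ 1 := by
    rw [he]; apply inv_le_one_of_one_le₀
    rw [Real.one_le_sqrt]; nlinarith [sq_nonneg ω]
  have hwe : w * e ≤ 1 := by
    rw [he, ← div_eq_mul_inv, div_le_one (by positivity)]
    apply Real.le_sqrt_of_sq_le; rw [← hww]; linarith
  have hr : rate ω = w ^ 6 * e ^ 8 := by
    rw [rate, div_eq_mul_inv, ← inv_pow, hee, show ω ^ 6 = (ω ^ 2) ^ 3 by ring, hww]; ring
  have b1 : ω ^ 2 / (1 + ω ^ 2) ^ 2 = w ^ 2 * e ^ 4 := by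
    rw [div_eq_mul_inv, ← inv_pow, hee, hww]; ring
  have b2 : ω ^ 4 / (1 + ω ^ 2) ^ 3 = w ^ 4 * e ^ 6 := by
    rw [div_eq_mul_inv, ← inv_pow, hee, show ω ^ 4 = (ω ^ 2) ^ 2 by ring, hww]; ring
  have b3 : ω ^ 6 / (1 + ω ^ 2) ^ 4 = w ^ 6 * e ^ 8 := hr
  have b4 : ω ^ 4 / (1 + ω ^ 2) ^ 4 = w ^ 4 * e ^ 8 := by
    rw [div_eq_mul_inv, ← inv_pow, hee, show ω ^ 4 = (ω ^ 2) ^ 2 by ring, hww]; ring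
  have mono : ∀ K i j Z : ℝ, 0 ≤ K → K ≤ A → 0 ≤ i → i ≤ 1 → 0 ≤ Z → j = K * (i * Z) →
      j ≤ A * Z := by
    intro K i j Z hK hKA hi hi1 hZ hj
    rw [hj]
    exact mul_le_mul hKA (mul_le_of_le_one_left hZ hi1) (by positivity) hA0.le
  have wk : ∀ c Z : ℝ, κ ≤ c → 0 ≤ Z → -(c * Z) ≤ -(κ * Z) := fun c Z h hZ =>
    neg_le_neg (mul_le_mul_of_nonneg_right h hZ)
  have l1 : ∀ i m : ℕ, 0 ≤ (w * e) ^ i * e ^ m ∧ (w * e) ^ i * e ^ m ≤ 1 := fun i m =>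
    ⟨by positivity, mul_le_one₀ (pow_le_one₀ (by positivity) hwe) (by positivity)
      (pow_le_one₀ he0 he1)⟩
  set xη := ‖X 6‖ with hxη
  set xu := ‖X 1‖ with hxu
  set xv := ‖X 0‖ with hxv
  set xs := ‖X 3 + X 5‖ with hxs
  set xq := ‖k₂ * X 2 + k₃ * X 4‖ with hxq
  set xp := ‖k₂ * X 3 + k₃ * X 5‖ with hxp
  set xr := ‖k₂ ^ 2 * X 2 + k₃ ^ 2 * X 4‖ with hxr
  have n6 : 0 ≤ xη := norm_nonneg _
  have n1 : 0 ≤ xu := norm_nonneg _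
  have n0 : 0 ≤ xv := norm_nonneg _
  have ns : 0 ≤ xs := norm_nonneg _
  have nq : 0 ≤ xq := norm_nonneg _
  have np : 0 ≤ xp := norm_nonneg _
  have nr : 0 ≤ xr := norm_nonneg _
  -- Each factor is the square root of the frequency weight of the corresponding good term. With
  -- these factors every product to be absorbed is a constant times a product of two of them, times
  -- some `(w e) ^ i * e ^ n ≤ 1`.
  set h := w * xη with hh
  set U := w ^ 2 * e ^ 2 * xu with hU
  set V := w ^ 3 * e ^ 3 * xv with hV
  set S := w ^ 3 * e ^ 4 * xs with hS
  set Q := w ^ 3 * e ^ 4 * xq with hQ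
  set P := w ^ 3 * e ^ 4 * xp with hP
  set R := w ^ 3 * e ^ 4 * xr with hR
  have ph : 0 ≤ h := by positivity
  have pU : 0 ≤ U := by positivity
  have pV : 0 ≤ V := by positivity
  have pS : 0 ≤ S := by positivity
  have pQ : 0 ≤ Q := by positivity
  have pP : 0 ≤ P := by positivity
  have pR : 0 ≤ R := by positivity
  have KA : ∀ K : ℝ, 0 ≤ A - K → K ≤ A := fun K h => by linarith
  have q1 : γ ≤ A := KA _ (by rw [hA]; ring_nf; positivity)
  have q2 : k₁ ≤ A := KA _ (by rw [hA]; ring_nf; positivity)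
  have q3 : k₄ ≤ A := KA _ (by rw [hA]; ring_nf; positivity)
  have q4 : (1 : ℝ) ≤ A := KA _ (by rw [hA]; ring_nf; positivity)
  have q5 : 2 * k₁ ≤ A := KA _ (by rw [hA]; ring_nf; positivity)
  have q6 : 2 * γ ≤ A := KA _ (by rw [hA]; ring_nf; positivity)
  have q7 : (2 : ℝ) ≤ A := KA _ (by rw [hA]; ring_nf; positivity)
  have q8 : (k₂ + k₃) * γ ≤ A := KA _ (by rw [hA]; ring_nf; positivity)
  have q9 : k₂ + k₃ ≤ A := KA _ (by rw [hA]; ring_nf; positivity)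
  have q10 : k₂ * k₃ ≤ A := KA _ (by rw [hA]; ring_nf; positivity)
  have q11 : (k₂ + k₃) ^ 2 ≤ A := KA _ (by rw [hA]; ring_nf; positivity)
  have q12 : (k₂ + k₃) * k₂ * k₃ ≤ A := KA _ (by rw [hA]; ring_nf; positivity)
  have m : ∀ (K j Z : ℝ) (i n : ℕ), 0 ≤ K → K ≤ A → 0 ≤ Z →
      j = K * (((w * e) ^ i * e ^ n) * Z) → j ≤ A * Z := fun K j Z i n hK hKA hZ hj =>
    mono K _ j Z hK hKA (l1 i n).1 (l1 i n).2 hZ hj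
  have D₀ : formDeriv (symbol k₁ k₂ k₃ k₄ γ ω) (energyForm k₁ k₂ k₃) X ≤ -(κ * h ^ 2) := by
    rw [formDeriv_energyForm, hww]
    have := wk (2 * k₄) (h ^ 2) hκ4 (by positivity)
    rw [hh] at this ⊢
    linarith
  have D₁ : (w ^ 2 * e ^ 4) * formDeriv (symbol k₁ k₂ k₃ k₄ γ ω) (ω • formUη) X ≤
      -(κ * U ^ 2) + A * (h * h + h * V + h * U) := by
    have := mul_le_mul_of_nonneg_left (formDeriv_formUη k₁ k₂ k₃ k₄ γ ω X hk₁.le hk₄.le)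
      (show 0 ≤ w ^ 2 * e ^ 4 by positivity)
    rw [hww] at this
    have t0 := wk γ (U ^ 2) hκγ (by positivity)
    have t1 := m γ (w ^ 2 * e ^ 4 * (γ * w ^ 2 * xη ^ 2)) (h * h) 2 2 hγ.le q1 (by positivity)
      (by rw [hh]; ring)
    have t2 := m k₁ (w ^ 2 * e ^ 4 * (k₁ * w ^ 2 * (xv * xη))) (h * V) 0 1 hk₁.le q2
      (by positivity) (by rw [hh, hV]; ring)
    have t3 := m k₄ (w ^ 2 * e ^ 4 * (k₄ * w ^ 3 * (xu * xη))) (h * U) 2 0 hk₄.le q3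
      (by positivity) (by rw [hh, hU]; ring)
    have t4 : w ^ 2 * e ^ 4 * (γ * w ^ 2 * xu ^ 2) = γ * U ^ 2 := by rw [hU]; ring
    linarith
  have D₂ : (w ^ 4 * e ^ 6) * formDeriv (symbol k₁ k₂ k₃ k₄ γ ω) (ω • formUV) X ≤
      -(κ * V ^ 2) + A * (h * V + U * U + U * S) := by
    have := mul_le_mul_of_nonneg_left (formDeriv_formUV k₁ k₂ k₃ k₄ γ ω X hγ.le)
      (show 0 ≤ w ^ 4 * e ^ 6 by positivity)
    rw [hww] at this
    have t0 := wk k₁ (V ^ 2) hκ1 (by positivity)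
    have t1 := m 1 (w ^ 4 * e ^ 6 * (w ^ 2 * xu ^ 2)) (U * U) 2 0 zero_le_one q4 (by positivity)
      (by rw [hU]; ring)
    have t2 := m γ (w ^ 4 * e ^ 6 * (γ * w ^ 2 * (xη * xv))) (h * V) 2 1 hγ.le q1
      (by positivity) (by rw [hh, hV]; ring)
    have t3 := m 1 (w ^ 4 * e ^ 6 * (w * (xu * xs))) (U * S) 0 0 zero_le_one q4
      (by positivity) (by rw [hU, hS]; ring)
    have t4 : w ^ 4 * e ^ 6 * (k₁ * w ^ 2 * xv ^ 2) = k₁ * V ^ 2 := by rw [hV]; ring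
    linarith
  have D₃ : (w ^ 6 * e ^ 8) * formDeriv (symbol k₁ k₂ k₃ k₄ γ ω) formVS X ≤
      -(κ * S ^ 2) + A * (V * V + U * S + V * Q) := by
    have := mul_le_mul_of_nonneg_left (formDeriv_formVS k₁ k₂ k₃ k₄ γ ω X)
      (show 0 ≤ w ^ 6 * e ^ 8 by positivity)
    have t0 := wk 1 (S ^ 2) hκo (by positivity)
    have t1 := m (2 * k₁) (w ^ 6 * e ^ 8 * (2 * k₁ * xv ^ 2)) (V * V) 0 2 (by positivity) q5
      (by positivity) (by rw [hV]; ring)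
    have t2 := m 1 (w ^ 6 * e ^ 8 * (w * (xu * xs))) (U * S) 2 0 zero_le_one q4
      (by positivity) (by rw [hU, hS]; ring)
    have t3 := m 1 (w ^ 6 * e ^ 8 * (w * (xv * xq))) (V * Q) 1 0 zero_le_one q4
      (by positivity) (by rw [hV, hQ]; ring)
    have t4 : w ^ 6 * e ^ 8 * xs ^ 2 = 1 * S ^ 2 := by rw [hS]; ring
    linarith
  have D₄ : (w ^ 4 * e ^ 8) * formDeriv (symbol k₁ k₂ k₃ k₄ γ ω) (formSQ k₂ k₃ ω 1) X ≤
      -(κ * Q ^ 2) + A * (S * P + h * Q + U * P) := by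
    have := mul_le_mul_of_nonneg_left (formDeriv_formSQ k₁ k₂ k₃ k₄ γ ω X hγ.le)
      (show 0 ≤ w ^ 4 * e ^ 8 by positivity)
    rw [hww] at this
    have t0 := wk 1 (Q ^ 2) hκo (by positivity)
    have t1 := m 1 (w ^ 4 * e ^ 8 * (w ^ 2 * (xs * xp))) (S * P) 0 0 zero_le_one q4
      (by positivity) (by rw [hS, hP]; ring)
    have t2 := m (2 * γ) (w ^ 4 * e ^ 8 * (2 * γ * w * (xη * xq))) (h * Q) 1 3 (by positivity) q6
      (by positivity) (by rw [hh, hQ]; ring)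
    have t3 := m 2 (w ^ 4 * e ^ 8 * (2 * w * (xu * xp))) (U * P) 0 2 zero_le_two q7
      (by positivity) (by rw [hU, hP]; ring)
    have t4 : w ^ 4 * e ^ 8 * (w ^ 2 * xq ^ 2) = 1 * Q ^ 2 := by rw [hQ]; ring
    linarith
  have D₅ : (w ^ 4 * e ^ 8) * formDeriv (symbol k₁ k₂ k₃ k₄ γ ω) (formQP k₂ k₃ ω 1) X ≤
      -(κ * P ^ 2) + A * (Q * R + h * Q + U * P) := by
    have := mul_le_mul_of_nonneg_left
      (formDeriv_formQP k₁ k₂ k₃ k₄ γ ω X hk₂.le hk₃.le hγ.le)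
      (show 0 ≤ w ^ 4 * e ^ 8 by positivity)
    rw [hww] at this
    have t0 := wk 1 (P ^ 2) hκo (by positivity)
    have t1 := m 1 (w ^ 4 * e ^ 8 * (w ^ 2 * (xq * xr))) (Q * R) 0 0 zero_le_one q4
      (by positivity) (by rw [hQ, hR]; ring)
    have t2 := m ((k₂ + k₃) * γ) (w ^ 4 * e ^ 8 * ((k₂ + k₃) * γ * w * (xη * xq))) (h * Q) 1 3
      (by positivity) q8 (by positivity) (by rw [hh, hQ]; ring)
    have t3 := m (k₂ + k₃) (w ^ 4 * e ^ 8 * ((k₂ + k₃) * w * (xu * xp))) (U * P) 0 2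
      (by positivity) q9 (by positivity) (by rw [hU, hP]; ring)
    have t4 : w ^ 4 * e ^ 8 * (w ^ 2 * xp ^ 2) = 1 * P ^ 2 := by rw [hP]; ring
    linarith
  have D₆ : (w ^ 4 * e ^ 8) * formDeriv (symbol k₁ k₂ k₃ k₄ γ ω) (formPR k₂ k₃ ω 1) X ≤
      -(κ * R ^ 2) + A * (P * P + S * P + h * R + U * P + U * S) := by
    have := mul_le_mul_of_nonneg_left
      (formDeriv_formPR k₁ k₂ k₃ k₄ γ ω X hk₂.le hk₃.le hγ.le)
      (show 0 ≤ w ^ 4 * e ^ 8 by positivity)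
    rw [hww] at this
    have t0 := wk 1 (R ^ 2) hκo (by positivity)
    have t1 := m (k₂ + k₃) (w ^ 4 * e ^ 8 * ((k₂ + k₃) * w ^ 2 * xp ^ 2)) (P * P) 0 0
      (by positivity) q9 (by positivity) (by rw [hP]; ring)
    have t2 := m (k₂ * k₃) (w ^ 4 * e ^ 8 * (k₂ * k₃ * w ^ 2 * (xs * xp))) (S * P) 0 0
      (by positivity) q10 (by positivity) (by rw [hS, hP]; ring)
    have t3 := m ((k₂ + k₃) * γ) (w ^ 4 * e ^ 8 * ((k₂ + k₃) * γ * w * (xη * xr))) (h * R) 1 3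
      (by positivity) q8 (by positivity) (by rw [hh, hR]; ring)
    have t5 := m ((k₂ + k₃) ^ 2) (w ^ 4 * e ^ 8 * ((k₂ + k₃) ^ 2 * w * (xu * xp))) (U * P) 0 2
      (by positivity) q11 (by positivity) (by rw [hU, hP]; ring)
    have t6 := m ((k₂ + k₃) * k₂ * k₃) (w ^ 4 * e ^ 8 * ((k₂ + k₃) * k₂ * k₃ * w * (xu * xs)))
      (U * S) 0 2 (by positivity) q12 (by positivity) (by rw [hU, hS]; ring)
    have t4 : w ^ 4 * e ^ 8 * (w ^ 2 * xr ^ 2) = 1 * R ^ 2 := by rw [hR]; ring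
    linarith
  have rS : ∀ x : ℝ, rate ω * x ^ 2 = (w ^ 3 * e ^ 4 * x) ^ 2 := fun x => by rw [hr]; ring
  have sq_le : ∀ i n : ℕ, ∀ Z : ℝ, 0 ≤ Z → ((w * e) ^ i * e ^ n) * Z ≤ Z := fun i n Z hZ =>
    mul_le_of_le_one_left hZ (l1 i n).2
  refine ⟨h, U, V, ?_, ?_, ?_, ?_⟩
  · have := sq_le 4 4 (h ^ 2) (by positivity)
    rw [hh] at this ⊢; rw [hr]; linarith
  · have := sq_le 2 2 (U ^ 2) (by positivity)
    rw [hU] at this ⊢; rw [hr]; linarith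
  · have := sq_le 0 2 (V ^ 2) (by positivity)
    rw [hV] at this ⊢; rw [hr]; linarith
  · rw [rS, rS, rS, rS]
    have := chain_absorption hδ hδ1 hA0.le ph pU pV pS pQ pP pR D₀ D₁ D₂ D₃ D₄ D₅ D₆
    refine le_trans (le_of_eq ?_) this
    simp only [lyap, formDeriv_add, b1, b2, b3, b4]
    simp only [formDeriv_smul]
    ring

end dissipation

/-! ### Continuity and coercivity of the Lyapunov functional -/

lemma rate_nonneg (ω : ℝ) : 0 ≤ rate ω := by unfold rate; positivity

lemma continuous_rate : Continuous rate := by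
  unfold rate
  exact (continuous_id.pow 6).div (by fun_prop) fun x => by positivity

lemma formSQ_eq (k₂ k₃ ω : ℝ) :
    formSQ k₂ k₃ ω 1 = ω • formSQ k₂ k₃ 1 0 + formSQ k₂ k₃ 0 1 := by
  ext X i; fin_cases i <;> simp [formSQ] <;> ring

lemma formQP_eq (k₂ k₃ ω : ℝ) :
    formQP k₂ k₃ ω 1 = ω • formQP k₂ k₃ 1 0 + formQP k₂ k₃ 0 1 := by
  ext X i; fin_cases i <;> simp [formQP] <;> ring

lemma formPR_eq (k₂ k₃ ω : ℝ) :
    formPR k₂ k₃ ω 1 = ω • formPR k₂ k₃ 1 0 + formPR k₂ k₃ 0 1 := by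
  ext X i; fin_cases i <;> simp [formPR] <;> ring

lemma continuous_lyap (k₁ k₂ k₃ δ : ℝ) : Continuous (lyap k₁ k₂ k₃ δ) := by
  have hq : ∀ n m : ℕ, Continuous fun ω : ℝ => ω ^ n / (1 + ω ^ 2) ^ m := fun n m =>
    (continuous_id.pow n).div (by fun_prop) fun x => by positivity
  have hSQ : Continuous fun ω => formSQ k₂ k₃ ω 1 := by
    rw [funext (formSQ_eq k₂ k₃)]; fun_prop
  have hQP : Continuous fun ω => formQP k₂ k₃ ω 1 := by
    rw [funext (formQP_eq k₂ k₃)]; fun_prop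
  have hPR : Continuous fun ω => formPR k₂ k₃ ω 1 := by
    rw [funext (formPR_eq k₂ k₃)]; fun_prop
  unfold lyap
  have h1 := hq 2 2
  have h2 := hq 4 3
  have h3 := hq 6 4
  have h4 := hq 4 4
  fun_prop

lemma abs_pow_div_le_one (ω : ℝ) (n m : ℕ) (h : n ≤ 2 * m) :
    |ω ^ n / (1 + ω ^ 2) ^ m| ≤ 1 := by
  rw [abs_div, abs_pow, abs_of_nonneg (show 0 ≤ (1 + ω ^ 2) ^ m by positivity),
    div_le_one (by positivity)]
  have h1 : |ω| ≤ √(1 + ω ^ 2) := Real.abs_le_sqrt (by linarith)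
  have h2 : 1 ≤ √(1 + ω ^ 2) := by rw [Real.one_le_sqrt]; nlinarith [sq_nonneg ω]
  calc |ω| ^ n ≤ √(1 + ω ^ 2) ^ n := by gcongr
    _ ≤ √(1 + ω ^ 2) ^ (2 * m) := pow_le_pow_right₀ h2 h
    _ = (1 + ω ^ 2) ^ m := by rw [pow_mul, Real.sq_sqrt (by positivity)]

lemma norm_coeff_smul_le (T : State →L[ℂ] State) (δ ω : ℝ) (hδ : 0 ≤ δ) (hδ1 : δ ≤ 1)
    (j n m : ℕ) (hj : 1 ≤ j) (h : n ≤ 2 * m) :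
    ‖(δ ^ j * (ω ^ n / (1 + ω ^ 2) ^ m)) • T‖ ≤ δ * ‖T‖ := by
  rw [norm_smul, Real.norm_eq_abs, abs_mul, abs_of_nonneg (pow_nonneg hδ j)]
  gcongr
  calc _ ≤ δ ^ 1 * 1 := mul_le_mul (pow_le_pow_of_le_one hδ hδ1 hj)
        (abs_pow_div_le_one ω n m h) (abs_nonneg _) (by positivity)
    _ = δ := by ring

lemma norm_coeff_smul_smul_le (T : State →L[ℂ] State) (δ ω : ℝ) (hδ : 0 ≤ δ) (hδ1 : δ ≤ 1)
    (j n m : ℕ) (hj : 1 ≤ j) (h : n + 1 ≤ 2 * m) :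
    ‖(δ ^ j * (ω ^ n / (1 + ω ^ 2) ^ m)) • (ω • T)‖ ≤ δ * ‖T‖ := by
  have := norm_coeff_smul_le T δ ω hδ hδ1 j (n + 1) m hj h
  rwa [smul_smul, show δ ^ j * (ω ^ n / (1 + ω ^ 2) ^ m) * ω =
    δ ^ j * (ω ^ (n + 1) / (1 + ω ^ 2) ^ m) by ring]

/-- The frequency weights offset the growth of the forms, including their explicit factor `ω`, so
every correction is `O(δ)` uniformly in `ω`. Hence for small `δ` the functional inherits the
coercivity of the energy. -/
lemma exists_norm_lyap_sub_le (k₁ k₂ k₃ : ℝ) : ∃ K : ℝ, 0 < K ∧ ∀ δ : ℝ, 0 ≤ δ → δ ≤ 1 → ∀ ω : ℝ,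
    ‖lyap k₁ k₂ k₃ δ ω - energyForm k₁ k₂ k₃‖ ≤ K * δ := by
  refine ⟨1 + (‖formUη‖ + ‖formUV‖ + ‖formVS‖ + (‖formSQ k₂ k₃ 1 0‖ + ‖formSQ k₂ k₃ 0 1‖)
    + (‖formQP k₂ k₃ 1 0‖ + ‖formQP k₂ k₃ 0 1‖) + (‖formPR k₂ k₃ 1 0‖ + ‖formPR k₂ k₃ 0 1‖)),
    by positivity, fun δ h0 h1 ω => ?_⟩
  have e : lyap k₁ k₂ k₃ δ ω - energyForm k₁ k₂ k₃ =
    (δ ^ 12 * (ω ^ 2 / (1 + ω ^ 2) ^ 2)) • (ω • formUη)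
    + (δ ^ 22 * (ω ^ 4 / (1 + ω ^ 2) ^ 3)) • (ω • formUV)
    + (δ ^ 30 * (ω ^ 6 / (1 + ω ^ 2) ^ 4)) • formVS
    + ((δ ^ 36 * (ω ^ 4 / (1 + ω ^ 2) ^ 4)) • (ω • formSQ k₂ k₃ 1 0)
      + (δ ^ 36 * (ω ^ 4 / (1 + ω ^ 2) ^ 4)) • formSQ k₂ k₃ 0 1)
    + ((δ ^ 40 * (ω ^ 4 / (1 + ω ^ 2) ^ 4)) • (ω • formQP k₂ k₃ 1 0)
      + (δ ^ 40 * (ω ^ 4 / (1 + ω ^ 2) ^ 4)) • formQP k₂ k₃ 0 1)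
    + ((δ ^ 42 * (ω ^ 4 / (1 + ω ^ 2) ^ 4)) • (ω • formPR k₂ k₃ 1 0)
      + (δ ^ 42 * (ω ^ 4 / (1 + ω ^ 2) ^ 4)) • formPR k₂ k₃ 0 1) := by
    rw [lyap, formSQ_eq, formQP_eq, formPR_eq]
    simp only [smul_add]
    abel
  rw [e]
  have a1 := norm_coeff_smul_smul_le formUη δ ω h0 h1 12 2 2 (by norm_num) (by norm_num)
  have a2 := norm_coeff_smul_smul_le formUV δ ω h0 h1 22 4 3 (by norm_num) (by norm_num)
  have a3 := norm_coeff_smul_le formVS δ ω h0 h1 30 6 4 (by norm_num) (by norm_num)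
  have a4 := norm_coeff_smul_smul_le (formSQ k₂ k₃ 1 0) δ ω h0 h1 36 4 4 (by norm_num) (by norm_num)
  have a5 := norm_coeff_smul_le (formSQ k₂ k₃ 0 1) δ ω h0 h1 36 4 4 (by norm_num) (by norm_num)
  have a6 := norm_coeff_smul_smul_le (formQP k₂ k₃ 1 0) δ ω h0 h1 40 4 4 (by norm_num) (by norm_num)
  have a7 := norm_coeff_smul_le (formQP k₂ k₃ 0 1) δ ω h0 h1 40 4 4 (by norm_num) (by norm_num)
  have a8 := norm_coeff_smul_smul_le (formPR k₂ k₃ 1 0) δ ω h0 h1 42 4 4 (by norm_num) (by norm_num)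
  have a9 := norm_coeff_smul_le (formPR k₂ k₃ 0 1) δ ω h0 h1 42 4 4 (by norm_num) (by norm_num)
  refine (norm_add_le_of_le (norm_add_le_of_le (norm_add_le_of_le (norm_add_le_of_le
    (norm_add_le_of_le a1 a2) a3) (norm_add_le_of_le a4 a5)) (norm_add_le_of_le a6 a7))
    (norm_add_le_of_le a8 a9)).trans ?_
  linarith

lemma norm_sq_eq_sum (X : State) : ‖X‖ ^ 2 = ‖X 0‖ ^ 2 + ‖X 1‖ ^ 2 + ‖X 2‖ ^ 2 + ‖X 3‖ ^ 2
    + ‖X 4‖ ^ 2 + ‖X 5‖ ^ 2 + ‖X 6‖ ^ 2 := by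
  rw [EuclideanSpace.norm_sq_eq, Fin.sum_univ_seven]

lemma exists_energyForm_ge {k₁ k₂ k₃ : ℝ} (hk₁ : 0 < k₁) (hk₂ : 0 < k₂) (hk₃ : 0 < k₃) :
    ∃ c : ℝ, 0 < c ∧ ∀ X : State, c * ‖X‖ ^ 2 ≤ (inner ℂ X (energyForm k₁ k₂ k₃ X)).re := by
  set c := min (min k₁ k₂) (min k₃ 1) with hc
  have c1 : c ≤ k₁ := (min_le_left _ _).trans (min_le_left _ _)
  have c2 : c ≤ k₂ := (min_le_left _ _).trans (min_le_right _ _)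
  have c3 : c ≤ k₃ := (min_le_right _ _).trans (min_le_left _ _)
  have c4 : c ≤ 1 := (min_le_right _ _).trans (min_le_right _ _)
  refine ⟨c, by positivity, fun X => ?_⟩
  have : (inner ℂ X (energyForm k₁ k₂ k₃ X)).re = k₁ * ‖X 0‖ ^ 2 + ‖X 1‖ ^ 2 + k₂ * ‖X 2‖ ^ 2
      + ‖X 3‖ ^ 2 + k₃ * ‖X 4‖ ^ 2 + ‖X 5‖ ^ 2 + ‖X 6‖ ^ 2 := by
    simp only [PiLp.inner_apply, Fin.sum_univ_seven, energyForm, RCLike.inner_apply,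
      ← Complex.normSq_eq_norm_sq, Complex.normSq_apply]
    simp [-Complex.inner]
    ring
  rw [this, norm_sq_eq_sum]
  have m : ∀ (k : ℝ) (i : Fin 7), c ≤ k → c * ‖X i‖ ^ 2 ≤ k * ‖X i‖ ^ 2 := fun k i h =>
    mul_le_mul_of_nonneg_right h (by positivity)
  linarith [m _ 0 c1, m _ 1 c4, m _ 2 c2, m _ 3 c4, m _ 4 c3, m _ 5 c4, m _ 6 c4]

lemma norm_sq_le_of_mul_eq (d k : ℝ) (hd : d ≠ 0) {x a b : ℂ} (h : (d : ℂ) * x = a - k * b) :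
    ‖x‖ ^ 2 ≤ (2 * (1 + k ^ 2) / d ^ 2) * (‖a‖ ^ 2 + ‖b‖ ^ 2) := by
  have h1 : |d| * ‖x‖ ≤ ‖a‖ + |k| * ‖b‖ := by
    have := congrArg norm h
    rw [norm_mul, Complex.norm_real, Real.norm_eq_abs] at this
    rw [this]
    refine (norm_sub_le _ _).trans ?_
    rw [norm_mul, Complex.norm_real, Real.norm_eq_abs]
  have h2 : d ^ 2 * ‖x‖ ^ 2 ≤ 2 * (1 + k ^ 2) * (‖a‖ ^ 2 + ‖b‖ ^ 2) := by
    have h3 : (|d| * ‖x‖) ^ 2 ≤ (‖a‖ + |k| * ‖b‖) ^ 2 := by gcongr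
    rw [mul_pow, sq_abs] at h3
    have h4 : (‖a‖ + |k| * ‖b‖) ^ 2 ≤ 2 * (‖a‖ ^ 2 + k ^ 2 * ‖b‖ ^ 2) := by
      rw [← sq_abs k]; nlinarith [sq_nonneg (‖a‖ - |k| * ‖b‖)]
    nlinarith [mul_nonneg (sq_nonneg k) (sq_nonneg ‖a‖), sq_nonneg ‖b‖]
  rw [div_mul_eq_mul_div, le_div_iff₀ (by positivity)]
  linarith

/-- If `k₂ ≠ k₃` then the variables of the chain control the state. -/
lemma exists_norm_sq_le_chain {k₂ k₃ : ℝ} (hk₂ : 0 < k₂) (hk₃ : 0 < k₃) (hne : k₂ ≠ k₃) :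
    ∃ C : ℝ, 0 < C ∧ ∀ X : State, ‖X‖ ^ 2 ≤ C * (‖X 6‖ ^ 2 + ‖X 1‖ ^ 2 + ‖X 0‖ ^ 2
      + ‖X 3 + X 5‖ ^ 2 + ‖k₂ * X 2 + k₃ * X 4‖ ^ 2 + ‖k₂ * X 3 + k₃ * X 5‖ ^ 2
      + ‖k₂ ^ 2 * X 2 + k₃ ^ 2 * X 4‖ ^ 2) := by
  have hd : k₂ - k₃ ≠ 0 := sub_ne_zero.2 hne
  have hd' : k₃ - k₂ ≠ 0 := sub_ne_zero.2 hne.symm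
  set a := 2 * (1 + k₃ ^ 2) / (k₂ - k₃) ^ 2 with ha
  set b := 2 * (1 + k₂ ^ 2) / (k₃ - k₂) ^ 2 with hb
  set c := 2 * (1 + k₃ ^ 2) / (k₂ * (k₂ - k₃)) ^ 2 with hc
  set d := 2 * (1 + k₂ ^ 2) / (k₃ * (k₃ - k₂)) ^ 2 with hd
  have pa : 0 ≤ a := by positivity
  have pb : 0 ≤ b := by positivity
  have pc : 0 ≤ c := by positivity
  have pd : 0 ≤ d := by positivity
  refine ⟨1 + a + b + c + d, by positivity, fun X => ?_⟩
  -- Two Vandermonde systems: `(k₂ - k₃) y = p - k₃ s` and `k₂ (k₂ - k₃) z = r - k₃ q`, and the same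
  -- with `k₂` and `k₃` exchanged for `θ` and `ϕ`.
  have hy := norm_sq_le_of_mul_eq (k₂ - k₃) k₃ (by assumption) (x := X 3)
    (a := k₂ * X 3 + k₃ * X 5) (b := X 3 + X 5) (by push_cast; ring)
  have hθ := norm_sq_le_of_mul_eq (k₃ - k₂) k₂ (by assumption) (x := X 5)
    (a := k₂ * X 3 + k₃ * X 5) (b := X 3 + X 5) (by push_cast; ring)
  have hz := norm_sq_le_of_mul_eq (k₂ * (k₂ - k₃)) k₃ (by positivity) (x := X 2)
    (a := k₂ ^ 2 * X 2 + k₃ ^ 2 * X 4) (b := k₂ * X 2 + k₃ * X 4) (by push_cast; ring)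
  have hφ := norm_sq_le_of_mul_eq (k₃ * (k₃ - k₂)) k₂ (by positivity) (x := X 4)
    (a := k₂ ^ 2 * X 2 + k₃ ^ 2 * X 4) (b := k₂ * X 2 + k₃ * X 4) (by push_cast; ring)
  rw [← ha] at hy
  rw [← hb] at hθ
  rw [← hc] at hz
  rw [← hd] at hφ
  rw [norm_sq_eq_sum]
  have g : ∀ r s : ℝ, 0 ≤ r → 0 ≤ r * s ^ 2 := fun r s h => by positivity
  have n := fun s : ℝ => sq_nonneg s
  generalize ‖X 3 + X 5‖ = S at *
  generalize ‖k₂ * X 2 + k₃ * X 4‖ = Q at *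
  generalize ‖k₂ * X 3 + k₃ * X 5‖ = P at *
  generalize ‖k₂ ^ 2 * X 2 + k₃ ^ 2 * X 4‖ = R at *
  generalize ‖X 6‖ = E at *
  generalize ‖X 1‖ = U at *
  generalize ‖X 0‖ = V at *
  have expand : (1 + a + b + c + d) * (E ^ 2 + U ^ 2 + V ^ 2 + S ^ 2 + Q ^ 2 + P ^ 2 + R ^ 2)
    = (E ^ 2 + U ^ 2 + V ^ 2) + (a + b) * (P ^ 2 + S ^ 2) + (c + d) * (R ^ 2 + Q ^ 2)
      + (S ^ 2 + Q ^ 2 + P ^ 2 + R ^ 2) + (a + b) * (E ^ 2 + U ^ 2 + V ^ 2 + Q ^ 2 + R ^ 2)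
      + (c + d) * (E ^ 2 + U ^ 2 + V ^ 2 + S ^ 2 + P ^ 2) := by ring
  rw [expand]
  have u1 : 0 ≤ (a + b) * (E ^ 2 + U ^ 2 + V ^ 2 + Q ^ 2 + R ^ 2) := by positivity
  have u2 : 0 ≤ (c + d) * (E ^ 2 + U ^ 2 + V ^ 2 + S ^ 2 + P ^ 2) := by positivity
  linarith [n S, n Q, n P, n R]

/-- One `δ`, independent of the frequency, serves both purposes: absorbing the products of the chain
and keeping the corrections small against the energy. The dissipation then controls the whole state
with the factor `rate ω`. -/
theorem exists_lyapunov {k₁ k₂ k₃ k₄ γ : ℝ} (hk₁ : 0 < k₁) (hk₂ : 0 < k₂) (hk₃ : 0 < k₃)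
    (hk₄ : 0 < k₄) (hγ : 0 < γ) (hne : k₂ ≠ k₃) :
    ∃ (L : ℝ → State →L[ℂ] State) (c c' K : ℝ), Continuous L ∧ 0 < c ∧ 0 < c' ∧ 0 < K ∧
      (∀ ω, ‖L ω‖ ≤ K) ∧ (∀ ω X, c * ‖X‖ ^ 2 ≤ (inner ℂ X (L ω X)).re) ∧
      ∀ ω X, formDeriv (symbol k₁ k₂ k₃ k₄ γ ω) (L ω) X ≤ -(c' * rate ω * ‖X‖ ^ 2) := by
  obtain ⟨κ, A, hκ, hA, hdiss⟩ := exists_formDeriv_lyap_chain hk₁ hk₂ hk₃ hk₄ hγ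
  obtain ⟨K, hK, hlyap⟩ := exists_norm_lyap_sub_le k₁ k₂ k₃
  obtain ⟨c, hc, hE⟩ := exists_energyForm_ge hk₁ hk₂ hk₃
  obtain ⟨C, hC, hchain⟩ := exists_norm_sq_le_chain hk₂ hk₃ hne
  set δ := min 1 (min (κ / (80 * A)) (c / (2 * K))) with hδ
  have δ0 : 0 < δ := by positivity
  have δ1 : δ ≤ 1 := min_le_left _ _
  have δA : 40 * A * δ ≤ κ / 2 := by
    have : δ ≤ κ / (80 * A) := (min_le_right _ _).trans (min_le_left _ _)
    rw [le_div_iff₀ (by positivity)] at this; linarith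
  have δK : K * δ ≤ c / 2 := by
    have : δ ≤ c / (2 * K) := (min_le_right _ _).trans (min_le_right _ _)
    rw [le_div_iff₀ (by positivity)] at this; linarith
  -- `δ ^ 42` is the smallest weight in the chain, hence a common lower bound for all of them.
  refine ⟨lyap k₁ k₂ k₃ δ, c / 2, κ / 2 * δ ^ 42 / C, ‖energyForm k₁ k₂ k₃‖ + K,
    continuous_lyap _ _ _ _, by positivity, by positivity, by positivity, ?_, ?_, ?_⟩
  · intro ω
    have := hlyap δ δ0.le δ1 ω
    calc _ = ‖energyForm k₁ k₂ k₃ + (lyap k₁ k₂ k₃ δ ω - energyForm k₁ k₂ k₃)‖ := by congr 1; abel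
      _ ≤ _ := norm_add_le_of_le le_rfl (this.trans (mul_le_of_le_one_right hK.le δ1))
  · intro ω X
    have h1 := hE X
    have h2 : (inner ℂ X (lyap k₁ k₂ k₃ δ ω X)).re = (inner ℂ X (energyForm k₁ k₂ k₃ X)).re
        + (inner ℂ X ((lyap k₁ k₂ k₃ δ ω - energyForm k₁ k₂ k₃) X)).re := by
      simp
    have h3 : ‖inner ℂ X ((lyap k₁ k₂ k₃ δ ω - energyForm k₁ k₂ k₃) X)‖ ≤ c / 2 * ‖X‖ ^ 2 := by
      refine (norm_inner_le_norm _ _).trans ?_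
      have := ((lyap k₁ k₂ k₃ δ ω - energyForm k₁ k₂ k₃).le_opNorm X).trans
        (mul_le_mul_of_nonneg_right ((hlyap δ δ0.le δ1 ω).trans δK) (norm_nonneg X))
      nlinarith [norm_nonneg X]
    have h4 := (abs_le.1 ((Complex.abs_re_le_norm _).trans h3)).1
    linarith
  · intro ω X
    obtain ⟨h, U, V, ih, iU, iV, hD⟩ := hdiss δ δ0.le δ1 ω X
    refine hD.trans (neg_le_neg ?_)
    have r0 := rate_nonneg ω
    have p : ∀ n : ℕ, n ≤ 42 → δ ^ 42 ≤ δ ^ n := fun n hn => pow_le_pow_of_le_one δ0.le δ1 hn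
    have mm : ∀ (n : ℕ) (x y : ℝ), n ≤ 42 → 0 ≤ x → x ≤ y → δ ^ 42 * x ≤ δ ^ n * y :=
      fun n x y hn hx hxy => mul_le_mul (p n hn) hxy hx (by positivity)
    have t0 := mm 0 _ _ (by norm_num) (by positivity) ih
    have t1 := mm 12 _ _ (by norm_num) (by positivity) iU
    have t2 := mm 22 _ _ (by norm_num) (by positivity) iV
    have t3 := mm 30 (rate ω * ‖X 3 + X 5‖ ^ 2) _ (by norm_num) (by positivity) le_rfl
    have t4 := mm 36 (rate ω * ‖k₂ * X 2 + k₃ * X 4‖ ^ 2) _ (by norm_num) (by positivity) le_rfl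
    have t5 := mm 40 (rate ω * ‖k₂ * X 3 + k₃ * X 5‖ ^ 2) _ (by norm_num) (by positivity) le_rfl
    have hX := mul_le_mul_of_nonneg_left (hchain X) (show 0 ≤ δ ^ 42 * rate ω by positivity)
    have hsum : δ ^ 42 * rate ω * ‖X‖ ^ 2 / C ≤ h ^ 2 + δ ^ 12 * U ^ 2 + δ ^ 22 * V ^ 2
          + δ ^ 30 * (rate ω * ‖X 3 + X 5‖ ^ 2)
          + δ ^ 36 * (rate ω * ‖k₂ * X 2 + k₃ * X 4‖ ^ 2)
          + δ ^ 40 * (rate ω * ‖k₂ * X 3 + k₃ * X 5‖ ^ 2)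
          + δ ^ 42 * (rate ω * ‖k₂ ^ 2 * X 2 + k₃ ^ 2 * X 4‖ ^ 2) := by
      rw [div_le_iff₀ hC]
      refine hX.trans ?_
      rw [mul_left_comm, mul_comm C]
      refine mul_le_mul_of_nonneg_right ?_ hC.le
      linarith
    calc κ / 2 * δ ^ 42 / C * rate ω * ‖X‖ ^ 2 = κ / 2 * (δ ^ 42 * rate ω * ‖X‖ ^ 2 / C) := by ring
      _ ≤ _ := mul_le_mul (by linarith) hsum (by positivity) (by linarith)

open scoped ENNReal FourierTransform

/-! ### Multiplication operators on `L²` -/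

/-- Pointwise multiplication by a bounded field of operators. -/
def mulOp (m : ℝ → State →L[ℂ] State) (hm : MemLp m ∞ (volume : Measure ℝ)) : L2 →L[ℂ] L2 :=
  (ContinuousLinearMap.id ℂ (State →L[ℂ] State)).holderL volume ∞ 2 2 (hm.toLp m)

lemma mulOp_apply (m : ℝ → State →L[ℂ] State) (hm : MemLp m ∞ (volume : Measure ℝ)) (f : L2) :
    mulOp m hm f =ᵐ[volume] fun ξ => m ξ (f ξ) := by
  have h := (ContinuousLinearMap.id ℂ (State →L[ℂ] State)).coeFn_holder (r := 2) (hm.toLp m) f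
  filter_upwards [h, hm.coeFn_toLp] with ξ h1 h2
  rw [mulOp, ContinuousLinearMap.holderL_apply_apply, h1, h2]; rfl

/-- The weight `(1 + ω²)⁻¹` at `ω = 2 π ξ`. -/
def wgt (ξ : ℝ) : ℝ := (1 + (2 * Real.pi * ξ) ^ 2)⁻¹

lemma wgt_pos (ξ : ℝ) : 0 < wgt ξ := by unfold wgt; positivity

lemma wgt_le_one (ξ : ℝ) : wgt ξ ≤ 1 := by
  unfold wgt; apply inv_le_one_of_one_le₀; nlinarith [sq_nonneg (2 * Real.pi * ξ)]

lemma continuous_wgt : Continuous wgt := by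
  unfold wgt; exact Continuous.inv₀ (by fun_prop) fun x => by positivity

lemma continuous_symbol (k₁ k₂ k₃ k₄ γ : ℝ) : Continuous (symbol k₁ k₂ k₃ k₄ γ) := by
  unfold symbol; fun_prop

lemma memLp_top_of_continuous {E : Type*} [NormedAddCommGroup E] {m : ℝ → E}
    [SecondCountableTopologyEither ℝ E] (hm : Continuous m) (C : ℝ)
    (h : ∀ ξ, ‖m ξ‖ ≤ C) : MemLp m ∞ (volume : Measure ℝ) :=
  memLp_top_of_bound hm.aestronglyMeasurable C (Filter.Eventually.of_forall h)

lemma exists_norm_wgt_smul_symbol_le (k₁ k₂ k₃ k₄ γ : ℝ) : ∃ C : ℝ, ∀ ξ : ℝ,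
    ‖wgt ξ • symbol k₁ k₂ k₃ k₄ γ (2 * Real.pi * ξ)‖ ≤ C := by
  refine ⟨‖A₂L k₄‖ + ‖A₁L k₁ k₂ k₃ γ‖ + ‖A₀L k₁‖, fun ξ => ?_⟩
  set ω := 2 * Real.pi * ξ with hω
  have hw : wgt ξ = 1 / (1 + ω ^ 2) ^ 1 := by simp [wgt, hω]
  have h2 := abs_pow_div_le_one ω 2 1 (by norm_num)
  have h1 := abs_pow_div_le_one ω 1 1 (by norm_num)
  have h0 := abs_pow_div_le_one ω 0 1 (by norm_num)
  have e : wgt ξ • symbol k₁ k₂ k₃ k₄ γ ω = (((ω ^ 2 / (1 + ω ^ 2) ^ 1 : ℝ) : ℂ)) • A₂L k₄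
      - (Complex.I * ((ω ^ 1 / (1 + ω ^ 2) ^ 1 : ℝ) : ℂ)) • A₁L k₁ k₂ k₃ γ
      - ((ω ^ 0 / (1 + ω ^ 2) ^ 1 : ℝ) : ℂ) • A₀L k₁ := by
    ext X i
    rw [hw]
    simp [symbol]
    field_simp
  rw [e]
  refine (norm_sub_le_of_le (norm_sub_le_of_le (?_ : _ ≤ ‖A₂L k₄‖) (?_ : _ ≤ ‖A₁L k₁ k₂ k₃ γ‖))
    (?_ : _ ≤ ‖A₀L k₁‖))
  · rw [norm_smul, Complex.norm_real]; exact mul_le_of_le_one_left (norm_nonneg _) h2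
  · rw [norm_smul, norm_mul, Complex.norm_I, one_mul, Complex.norm_real]
    exact mul_le_of_le_one_left (norm_nonneg _) h1
  · rw [norm_smul, Complex.norm_real]; exact mul_le_of_le_one_left (norm_nonneg _) h0

lemma memLp_wgt_symbol (k₁ k₂ k₃ k₄ γ : ℝ) :
    MemLp (fun ξ : ℝ => wgt ξ • symbol k₁ k₂ k₃ k₄ γ (2 * Real.pi * ξ)) ∞ volume := by
  obtain ⟨C, hC⟩ := exists_norm_wgt_smul_symbol_le k₁ k₂ k₃ k₄ γ
  exact memLp_top_of_continuous (continuous_wgt.smul ((continuous_symbol _ _ _ _ _).comp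
    (by fun_prop))) C hC

lemma memLp_wgt_id :
    MemLp (fun ξ : ℝ => wgt ξ • ContinuousLinearMap.id ℂ State) ∞ volume := by
  refine memLp_top_of_continuous (continuous_wgt.smul continuous_const)
    ‖ContinuousLinearMap.id ℂ State‖ fun ξ => ?_
  rw [norm_smul, Real.norm_eq_abs, abs_of_pos (wgt_pos ξ)]
  exact mul_le_of_le_one_left (norm_nonneg _) (wgt_le_one ξ)

/-- Multiplication by the weight. -/
def wOp : L2 →L[ℂ] L2 := mulOp _ memLp_wgt_id

/-- Multiplication by the weighted symbol. -/
def wSymbolOp (k₁ k₂ k₃ k₄ γ : ℝ) : L2 →L[ℂ] L2 := mulOp _ (memLp_wgt_symbol k₁ k₂ k₃ k₄ γ)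

lemma wOp_apply (f : L2) : wOp f =ᵐ[volume] fun ξ => wgt ξ • f ξ := mulOp_apply _ _ f

lemma wSymbolOp_apply (k₁ k₂ k₃ k₄ γ : ℝ) (f : L2) : wSymbolOp k₁ k₂ k₃ k₄ γ f =ᵐ[volume]
    fun ξ => wgt ξ • symbol k₁ k₂ k₃ k₄ γ (2 * Real.pi * ξ) (f ξ) := mulOp_apply _ _ f

/-! ### Weak solutions on the Fourier side -/

/-- `Z` solves the Fourier transformed system in the sense of distributions. -/
def IsWeakFourierSolution (k₁ k₂ k₃ k₄ γ : ℝ) (Z : ℝ → L2) : Prop :=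
  ∀ t : ℝ, 0 < t → ∀ h : 𝓢(ℝ, ℂ),
    HasDerivAt (fun s => ∫ ξ, h ξ • Z s ξ)
      (∫ ξ, h ξ • symbol k₁ k₂ k₃ k₄ γ (2 * Real.pi * ξ) (Z t ξ)) t

/-- Pairing with a square-integrable scalar function. -/
def pairL (h : Lp ℂ 2 (volume : Measure ℝ)) : L2 →L[ℂ] State :=
  (ContinuousLinearMap.lsmul ℂ ℂ).lpPairing volume 2 2 h

lemma pairL_apply {h : ℝ → ℂ} (hh : MemLp h 2 (volume : Measure ℝ)) (f : L2) :
    pairL (hh.toLp h) f = ∫ ξ, h ξ • f ξ := by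
  rw [pairL, ContinuousLinearMap.lpPairing_eq_integral]
  refine integral_congr_ae ?_
  filter_upwards [hh.coeFn_toLp] with ξ h1
  rw [h1]; rfl

lemma integrable_smul_L2 {h : ℝ → ℂ} (hh : MemLp h 2 (volume : Measure ℝ)) (f : L2) :
    Integrable (fun ξ => h ξ • f ξ) :=
  memLp_one_iff_integrable.1 ((Lp.memLp f).smul hh)

/-- A continuous weak solution is, after weighting, a strong solution in `L²`. -/
lemma IsWeakFourierSolution.hasDerivAt_wOp {k₁ k₂ k₃ k₄ γ : ℝ} {Z : ℝ → L2}
    (hZ : IsWeakFourierSolution k₁ k₂ k₃ k₄ γ Z) (hc : Continuous Z) {t : ℝ} (ht : 0 < t) :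
    HasDerivAt (fun s => wOp (Z s)) (wSymbolOp k₁ k₂ k₃ k₄ γ (Z t)) t := by
  set G : ℝ → L2 := fun s => wSymbolOp k₁ k₂ k₃ k₄ γ (Z s) with hG
  have hGc : Continuous G := (wSymbolOp k₁ k₂ k₃ k₄ γ).continuous.comp hc
  have key : ∀ s, 0 < s → wOp (Z s) = wOp (Z 0) + ∫ τ in (0 : ℝ)..s, G τ := by
    intro s hs
    set K : L2 := ∫ τ in (0 : ℝ)..s, G τ with hK
    -- The integrated equation with the weight divided out. The quotient is only locally integrable,
    -- so it is tested against compactly supported functions.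
    have hae : ∀ᵐ ξ : ℝ, (Z s ξ - Z 0 ξ - (wgt ξ)⁻¹ • K ξ) = 0 := by
      apply ae_eq_zero_of_integral_contDiff_smul_eq_zero
      · have hKl : LocallyIntegrable (fun ξ => K ξ) volume :=
          (Lp.memLp K).locallyIntegrable (by norm_num)
        have h1 : LocallyIntegrable (fun ξ => (wgt ξ)⁻¹ • K ξ) volume := by
          have := (hKl.locallyIntegrableOn Set.univ).continuousOn_smul isOpen_univ.isLocallyClosed
            (f := K) (g := fun ξ => (wgt ξ)⁻¹)
            ((continuous_wgt.inv₀ fun x => (wgt_pos x).ne').continuousOn)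
          exact locallyIntegrableOn_univ.1 this
        exact ((((Lp.memLp (Z s)).locallyIntegrable (by norm_num)).sub
          ((Lp.memLp (Z 0)).locallyIntegrable (by norm_num)))).sub h1
      · intro g g_smooth g_cpt
        have hg₁ : HasCompactSupport (Complex.ofRealCLM ∘ g) := g_cpt.comp_left rfl
        have hg₂ : ContDiff ℝ ((⊤ : ℕ∞) : WithTop ℕ∞) (Complex.ofRealCLM ∘ g) := by fun_prop
        set h : 𝓢(ℝ, ℂ) := hg₁.toSchwartzMap hg₂ with hh
        have hhg : ∀ ξ, h ξ = (g ξ : ℂ) := fun ξ => rfl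
        have hmem : MemLp (fun ξ => (g ξ : ℂ)) 2 (volume : Measure ℝ) :=
          (Complex.continuous_ofReal.comp g_smooth.continuous).memLp_of_hasCompactSupport
            (g_cpt.comp_left (g := Complex.ofReal) rfl)
        -- Compact support of `g` makes the growth of `(wgt ξ)⁻¹` harmless, so the unbounded symbol
        -- can be moved into a bounded pairing with `G`.
        have hmem' : MemLp (fun ξ => ((g ξ * (wgt ξ)⁻¹ : ℝ) : ℂ)) 2 (volume : Measure ℝ) := by
          refine Continuous.memLp_of_hasCompactSupport (Complex.continuous_ofReal.comp
            (g_smooth.continuous.mul (continuous_wgt.inv₀ fun x => (wgt_pos x).ne'))) ?_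
          exact (g_cpt.mul_right (f' := fun ξ => (wgt ξ)⁻¹)).comp_left (g := Complex.ofReal) rfl
        have hF : ∀ r, pairL (hmem.toLp _) (Z r) = ∫ ξ, h ξ • Z r ξ := fun r => by
          rw [pairL_apply hmem]; rfl
        have hF' : ∀ r, pairL (hmem'.toLp _) (G r) =
            ∫ ξ, h ξ • symbol k₁ k₂ k₃ k₄ γ (2 * Real.pi * ξ) (Z r ξ) := fun r => by
          rw [pairL_apply hmem']
          refine integral_congr_ae ?_
          filter_upwards [wSymbolOp_apply k₁ k₂ k₃ k₄ γ (Z r)] with ξ h1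
          rw [hG, h1, hhg, ← Complex.coe_smul (wgt ξ), smul_smul, ← Complex.ofReal_mul, mul_assoc,
            inv_mul_cancel₀ (wgt_pos ξ).ne', mul_one]
        have hFTC : ∫ τ in (0 : ℝ)..s, pairL (hmem'.toLp _) (G τ) =
            pairL (hmem.toLp _) (Z s) - pairL (hmem.toLp _) (Z 0) := by
          apply intervalIntegral.integral_eq_sub_of_hasDerivAt_of_le hs.le
            (f := fun r => pairL (hmem.toLp _) (Z r))
          · exact ((pairL _).continuous.comp hc).continuousOn
          · intro r hr
            rw [hF', funext hF]
            exact hZ r hr.1 h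
          · exact ((pairL _).continuous.comp hGc).intervalIntegrable _ _
        rw [ContinuousLinearMap.intervalIntegral_comp_comm _ (hGc.intervalIntegrable _ _), ← hK,
          pairL_apply hmem', pairL_apply hmem, pairL_apply hmem] at hFTC
        have e : ∀ ξ, g ξ • (Z s ξ - Z 0 ξ - (wgt ξ)⁻¹ • K ξ) = ((g ξ : ℂ) • Z s ξ
            - (g ξ : ℂ) • Z 0 ξ) - ((g ξ * (wgt ξ)⁻¹ : ℝ) : ℂ) • K ξ := fun ξ => by
          simp only [Complex.coe_smul, smul_sub, smul_smul]
        simp only [e]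
        have hi : Integrable fun ξ => (g ξ : ℂ) • Z s ξ - (g ξ : ℂ) • Z 0 ξ :=
          (integrable_smul_L2 hmem _).sub (integrable_smul_L2 hmem _)
        rw [integral_sub hi (integrable_smul_L2 hmem' _), integral_sub (integrable_smul_L2 hmem _)
          (integrable_smul_L2 hmem _), hFTC, sub_self]
    apply Lp.ext
    filter_upwards [hae, wOp_apply (Z s), wOp_apply (Z 0), Lp.coeFn_add (wOp (Z 0)) K]
      with ξ h1 h2 h3 h4
    rw [h2, h4, Pi.add_apply, h3]
    have := congrArg (fun x => wgt ξ • x) h1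
    simp only [smul_sub, smul_smul, mul_inv_cancel₀ (wgt_pos ξ).ne', one_smul, smul_zero] at this
    rw [sub_eq_zero, sub_eq_iff_eq_add] at this
    rw [this, add_comm]
  have h1 : HasDerivAt (fun s => wOp (Z 0) + ∫ τ in (0 : ℝ)..s, G τ) (G t) t := by
    have := intervalIntegral.integral_hasDerivAt_right (hGc.intervalIntegrable 0 t)
      (hGc.stronglyMeasurableAtFilter _ _) hGc.continuousAt
    exact this.const_add _
  exact h1.congr_of_eventuallyEq (by
    filter_upwards [lt_mem_nhds ht] with s hs using key s hs)

/-! ### Decay of the Fourier transform -/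

lemma re_inner_L2 (f g : L2) : (inner ℂ f g).re = ∫ ξ, (inner ℂ (f ξ) (g ξ)).re := by
  rw [L2.inner_def]
  exact (integral_re (L2.integrable_inner (𝕜 := ℂ) f g)).symm

lemma integrable_re_inner_L2 (f g : L2) : Integrable fun ξ => (inner ℂ (f ξ) (g ξ)).re :=
  (L2.integrable_inner (𝕜 := ℂ) f g).re

lemma integrable_norm_sq_L2 (f : L2) : Integrable fun ξ => ‖f ξ‖ ^ 2 :=
  (memLp_two_iff_integrable_sq_norm (Lp.memLp f).1).1 (Lp.memLp f)

lemma le_exp_mul_of_hasDerivAt_le {Φ Φ' : ℝ → ℝ} {lam t : ℝ} (ht : 0 ≤ t) (hc : Continuous Φ)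
    (hd : ∀ s, 0 < s → HasDerivAt Φ (Φ' s) s) (hle : ∀ s, 0 < s → Φ' s ≤ -(lam * Φ s)) :
    Φ t ≤ Real.exp (-(lam * t)) * Φ 0 := by
  have hder : ∀ s, 0 < s → HasDerivAt (fun s => Real.exp (lam * s) * Φ s)
      (Real.exp (lam * s) * (lam * 1) * Φ s + Real.exp (lam * s) * Φ' s) s := fun s hs =>
    (((hasDerivAt_id s).const_mul lam).exp).mul (hd s hs)
  have hanti : AntitoneOn (fun s => Real.exp (lam * s) * Φ s) (Set.Icc 0 t) := by
    apply antitoneOn_of_deriv_nonpos (convex_Icc 0 t)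
    · exact (by fun_prop : Continuous _).continuousOn
    · intro s hs
      rw [interior_Icc] at hs
      exact (hder s hs.1).differentiableAt.differentiableWithinAt
    · intro s hs
      rw [interior_Icc] at hs
      rw [(hder s hs.1).deriv]
      have := mul_le_mul_of_nonneg_left (hle s hs.1) (Real.exp_pos (lam * s)).le
      linarith
  have h := hanti (Set.left_mem_Icc.2 ht) (Set.right_mem_Icc.2 ht) ht
  simp only [mul_zero, Real.exp_zero, one_mul] at h
  have h2 := mul_le_mul_of_nonneg_left h (Real.exp_pos (-(lam * t))).le
  rwa [← mul_assoc, ← Real.exp_add, neg_add_cancel, Real.exp_zero, one_mul] at h2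

section decay

variable {k₁ k₂ k₃ k₄ γ : ℝ} {L : ℝ → State →L[ℂ] State} {c c' K : ℝ}

/-- Grönwall for the Lyapunov functional restricted to the frequencies in `B`. Multiplication
operators do not mix frequencies, so the restriction is compatible with the flow, and on `B` the
dissipation has the uniform rate `ρ₀`. -/
lemma IsWeakFourierSolution.setIntegral_le {Z : ℝ → L2}
    (hZ : IsWeakFourierSolution k₁ k₂ k₃ k₄ γ Z) (hZc : Continuous Z)
    (hLc : Continuous L) (hc' : 0 < c') (hK : 0 < K)
    (hLK : ∀ ω, ‖L ω‖ ≤ K) (hcoer : ∀ ω X, c * ‖X‖ ^ 2 ≤ (inner ℂ X (L ω X)).re)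
    (hdiss : ∀ ω X, formDeriv (symbol k₁ k₂ k₃ k₄ γ ω) (L ω) X ≤ -(c' * rate ω * ‖X‖ ^ 2))
    {ρ₀ : ℝ} (hρ₀ : 0 ≤ ρ₀) {B : Set ℝ} (hB : MeasurableSet B)
    (hBρ : ∀ ξ ∈ B, ρ₀ ≤ rate (2 * Real.pi * ξ)) {t : ℝ} (ht : 0 ≤ t) :
    c * ∫ ξ in B, ‖wOp (Z t) ξ‖ ^ 2 ≤
      Real.exp (-(c' * ρ₀ / K * t)) * (K * ∫ ξ in B, ‖wOp (Z 0) ξ‖ ^ 2) := by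
  have hreK : ∀ ω X, (inner ℂ X (L ω X)).re ≤ K * ‖X‖ ^ 2 := fun ω X => by
    refine (Complex.re_le_norm _).trans ((norm_inner_le_norm _ _).trans ?_)
    have := (L ω).le_of_opNorm_le (hLK ω) X
    nlinarith [norm_nonneg X]
  have hm : MemLp (B.indicator fun ξ => L (2 * Real.pi * ξ)) ∞ (volume : Measure ℝ) :=
    (memLp_top_of_continuous (hLc.comp (by fun_prop)) K fun ξ => hLK _).indicator hB
  set P : L2 →L[ℂ] L2 := mulOp _ hm with hP
  set Y : ℝ → L2 := fun s => wOp (Z s) with hY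
  have hYc : Continuous Y := wOp.continuous.comp hZc
  set Φ : ℝ → ℝ := fun s => (inner ℂ (Y s) (P (Y s))).re
  have hΦs : ∀ s, Φ s = (inner ℂ (Y s) (P (Y s))).re := fun _ => rfl
  have hPae : ∀ f : L2, P f =ᵐ[volume] B.indicator fun ξ => L (2 * Real.pi * ξ) (f ξ) := by
    intro f
    filter_upwards [mulOp_apply _ hm f] with ξ h
    rw [hP, h]
    by_cases hξ : ξ ∈ B <;> simp [hξ]
  have hΦint : ∀ s, Φ s = ∫ ξ in B, (inner ℂ (Y s ξ) (L (2 * Real.pi * ξ) (Y s ξ))).re := by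
    intro s
    rw [hΦs, re_inner_L2, ← integral_indicator hB]
    refine integral_congr_ae ?_
    filter_upwards [hPae (Y s)] with ξ h
    rw [h]
    by_cases hξ : ξ ∈ B <;> simp [hξ]
  have hΦi : ∀ s, IntegrableOn (fun ξ => (inner ℂ (Y s ξ) (L (2 * Real.pi * ξ) (Y s ξ))).re) B := by
    intro s
    rw [← integrable_indicator_iff hB]
    refine (integrable_re_inner_L2 (Y s) (P (Y s))).congr ?_
    filter_upwards [hPae (Y s)] with ξ h
    rw [h]
    by_cases hξ : ξ ∈ B <;> simp [hξ]
  have hΦc : Continuous Φ :=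
    Complex.continuous_re.comp (hYc.inner (P.continuous.comp hYc))
  have hΦd : ∀ s, 0 < s → HasDerivAt Φ ((inner ℂ (Y s) (P (wSymbolOp k₁ k₂ k₃ k₄ γ (Z s)))
      + inner ℂ (wSymbolOp k₁ k₂ k₃ k₄ γ (Z s)) (P (Y s))).re) s := by
    intro s hs
    have h1 := hZ.hasDerivAt_wOp hZc hs
    have h2 : HasDerivAt (fun s => P (Y s)) (P (wSymbolOp k₁ k₂ k₃ k₄ γ (Z s))) s :=
      (P.restrictScalars ℝ).hasFDerivAt.comp_hasDerivAt s h1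
    exact Complex.reCLM.hasFDerivAt.comp_hasDerivAt s (h1.inner ℂ h2)
  have hΦle : ∀ s, 0 < s → (inner ℂ (Y s) (P (wSymbolOp k₁ k₂ k₃ k₄ γ (Z s)))
      + inner ℂ (wSymbolOp k₁ k₂ k₃ k₄ γ (Z s)) (P (Y s))).re ≤ -(c' * ρ₀ / K * Φ s) := by
    intro s hs
    rw [Complex.add_re, re_inner_L2, re_inner_L2, ← integral_add (integrable_re_inner_L2 _ _)
      (integrable_re_inner_L2 _ _), hΦs, re_inner_L2, ← integral_const_mul, ← integral_neg]
    refine integral_mono_ae ((integrable_re_inner_L2 _ _).add (integrable_re_inner_L2 _ _))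
      (((integrable_re_inner_L2 _ _).const_mul _).neg) ?_
    filter_upwards [hPae (Y s), hPae (wSymbolOp k₁ k₂ k₃ k₄ γ (Z s)), wOp_apply (Z s),
      wSymbolOp_apply k₁ k₂ k₃ k₄ γ (Z s)] with ξ h1 h2 h3 h4
    -- The weight is scalar and commutes with the symbol, so the weighted curve obeys the same ODE
    -- and the pointwise dissipation inequality applies.
    have h5 : wSymbolOp k₁ k₂ k₃ k₄ γ (Z s) ξ = symbol k₁ k₂ k₃ k₄ γ (2 * Real.pi * ξ) (Y s ξ) := by
      rw [h4, hY, h3, ContinuousLinearMap.map_smul_of_tower]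
    rw [h1, h2, h5]
    by_cases hξ : ξ ∈ B
    · simp only [Set.indicator_of_mem hξ, h5]
      have hd := hdiss (2 * Real.pi * ξ) (Y s ξ)
      rw [formDeriv] at hd
      have hr := hBρ ξ hξ
      have hu := hreK (2 * Real.pi * ξ) (Y s ξ)
      have e1 : c' * ρ₀ / K * (inner ℂ (Y s ξ) (L (2 * Real.pi * ξ) (Y s ξ))).re ≤
          c' * ρ₀ * ‖Y s ξ‖ ^ 2 := by
        refine (mul_le_mul_of_nonneg_left hu (by positivity)).trans (le_of_eq ?_)
        field_simp
      have e2 : c' * ρ₀ * ‖Y s ξ‖ ^ 2 ≤ c' * rate (2 * Real.pi * ξ) * ‖Y s ξ‖ ^ 2 := by gcongr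
      linarith
    · simp [hξ]
  have hfin := le_exp_mul_of_hasDerivAt_le ht hΦc hΦd hΦle
  have hlow : c * ∫ ξ in B, ‖Y t ξ‖ ^ 2 ≤ Φ t := by
    rw [hΦint, ← integral_const_mul]
    exact integral_mono ((integrable_norm_sq_L2 _).integrableOn.const_mul c) (hΦi t)
      fun ξ => hcoer _ _
  have hup : Φ 0 ≤ K * ∫ ξ in B, ‖Y 0 ξ‖ ^ 2 := by
    rw [hΦint, ← integral_const_mul]
    exact integral_mono (hΦi 0) ((integrable_norm_sq_L2 _).integrableOn.const_mul K)
      fun ξ => hreK _ _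
  exact hlow.trans (hfin.trans (mul_le_mul_of_nonneg_left hup (Real.exp_pos _).le))

end decay

/-- Pointwise decay of the Fourier transform of a solution. -/
theorem exists_fourier_decay {k₁ k₂ k₃ k₄ γ : ℝ} (hk₁ : 0 < k₁) (hk₂ : 0 < k₂) (hk₃ : 0 < k₃)
    (hk₄ : 0 < k₄) (hγ : 0 < γ) (hne : k₂ ≠ k₃) :
    ∃ C a : ℝ, 0 < C ∧ 0 < a ∧ ∀ Z : ℝ → L2, IsWeakFourierSolution k₁ k₂ k₃ k₄ γ Z → Continuous Z →
      ∀ t, 0 ≤ t → ∀ᵐ ξ : ℝ, ‖Z t ξ‖ ^ 2 ≤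
        C * Real.exp (-(a * rate (2 * Real.pi * ξ) * t)) * ‖Z 0 ξ‖ ^ 2 := by
  obtain ⟨L, c, c', K, hLc, hc, hc', hK, hLK, hcoer, hdiss⟩ :=
    exists_lyapunov hk₁ hk₂ hk₃ hk₄ hγ hne
  refine ⟨K / c, c' / K, by positivity, by positivity, fun Z hZ hZc t ht => ?_⟩
  -- Rational thresholds, so that the exceptional null sets remain countable in number; integral
  -- bounds on all subsets of `{q ≤ rate}` give the pointwise one.
  have hrat : ∀ q : ℚ, ∀ᵐ ξ : ℝ, 0 ≤ (q : ℝ) → (q : ℝ) ≤ rate (2 * Real.pi * ξ) →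
      ‖wOp (Z t) ξ‖ ^ 2 ≤ K / c * Real.exp (-(c' / K * q * t)) * ‖wOp (Z 0) ξ‖ ^ 2 := by
    intro q
    by_cases hq : 0 ≤ (q : ℝ)
    swap
    · exact Filter.Eventually.of_forall fun ξ h => absurd h hq
    set S : Set ℝ := {ξ | (q : ℝ) ≤ rate (2 * Real.pi * ξ)} with hS
    have hSm : MeasurableSet S :=
      measurableSet_le measurable_const (continuous_rate.comp (by fun_prop)).measurable
    have h : (fun ξ => ‖wOp (Z t) ξ‖ ^ 2) ≤ᵐ[volume.restrict S]
        fun ξ => K / c * Real.exp (-(c' / K * q * t)) * ‖wOp (Z 0) ξ‖ ^ 2 := by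
      refine ae_le_of_forall_setIntegral_le (integrable_norm_sq_L2 _).integrableOn
        ((integrable_norm_sq_L2 _).integrableOn.const_mul _) fun s hs _ => ?_
      rw [Measure.restrict_restrict hs, integral_const_mul]
      have := hZ.setIntegral_le hZc hLc hc' hK hLK hcoer hdiss hq (hs.inter hSm)
        (fun ξ hξ => hξ.2) ht
      rw [mul_comm c, ← le_div_iff₀ hc] at this
      refine this.trans (le_of_eq ?_)
      rw [show c' / K * q * t = c' * q / K * t by ring]
      ring
    rw [Filter.EventuallyLE, ae_restrict_iff' hSm] at h
    filter_upwards [h] with ξ h _ using h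
  filter_upwards [ae_all_iff.2 hrat, wOp_apply (Z t), wOp_apply (Z 0)] with ξ h h1 h2
  have hw : ∀ q : ℚ, 0 ≤ (q : ℝ) → (q : ℝ) ≤ rate (2 * Real.pi * ξ) →
      ‖Z t ξ‖ ^ 2 ≤ K / c * Real.exp (-(c' / K * q * t)) * ‖Z 0 ξ‖ ^ 2 := by
    intro q hq hqr
    have := h q hq hqr
    -- The weight does not depend on time, so it cancels from both sides.
    rw [h1, h2, norm_smul, norm_smul, mul_pow, mul_pow, mul_left_comm] at this
    exact le_of_mul_le_mul_left this (pow_pos (norm_pos_iff.2 (wgt_pos ξ).ne') 2)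
  -- At rate zero the threshold `q = 0` is exact; otherwise rationals increase to the rate and the
  -- bound is continuous in `q`.
  rcases (rate_nonneg (2 * Real.pi * ξ)).eq_or_lt with h0 | h0
  · simpa [← h0] using hw 0 (by simp) (by simpa using h0.le)
  · have hcont : Continuous fun r : ℝ => K / c * Real.exp (-(c' / K * r * t)) * ‖Z 0 ξ‖ ^ 2 := by
      fun_prop
    refine le_of_forall_pos_lt_add fun ε hε => ?_
    have hev := (hcont.tendsto (rate (2 * Real.pi * ξ))).eventually
      (gt_mem_nhds (lt_add_of_pos_right _ hε))
    obtain ⟨l, hl, hl'⟩ := exists_Ioc_subset_of_mem_nhds hev ⟨0, h0⟩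
    obtain ⟨q, hq1, hq2⟩ := exists_rat_btwn (max_lt hl h0)
    exact (hw q ((le_max_right _ _).trans hq1.le) hq2.le).trans_lt
      (hl' ⟨(le_max_left _ _).trans_lt hq1, hq2.le⟩)

/-! ### The Fourier transform of derivatives and of solutions -/

/-- Multiplication of a Schwartz function by `2 π i ξ`. -/
def mulFreq (h : 𝓢(ℝ, ℂ)) : 𝓢(ℝ, ℂ) :=
  (2 * Real.pi * Complex.I) • SchwartzMap.smulLeftCLM ℂ (fun ξ : ℝ => (ξ : ℂ)) h

lemma hasTemperateGrowth_ofReal : (fun ξ : ℝ => (ξ : ℂ)).HasTemperateGrowth :=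
  Complex.ofRealCLM.hasTemperateGrowth

lemma mulFreq_apply (h : 𝓢(ℝ, ℂ)) (ξ : ℝ) :
    mulFreq h ξ = 2 * Real.pi * Complex.I * ξ * h ξ := by
  simp [mulFreq, SchwartzMap.smulLeftCLM_apply_apply hasTemperateGrowth_ofReal, mul_assoc]

lemma iterate_mulFreq_apply (n : ℕ) (h : 𝓢(ℝ, ℂ)) (ξ : ℝ) :
    mulFreq^[n] h ξ = (2 * Real.pi * Complex.I * ξ) ^ n * h ξ := by
  induction n with
  | zero => simp
  | succ n ih => rw [Function.iterate_succ_apply', mulFreq_apply, ih, pow_succ]; ring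

lemma dx_apply_fourier (T : 𝓢'(ℝ, State)) (h : 𝓢(ℝ, ℂ)) : dx T (𝓕 h) = T (𝓕 (mulFreq h)) := by
  have e := TemperedDistribution.fourier_lineDerivOp_eq T (1 : ℝ)
  have e2 := congrArg (fun S : 𝓢'(ℝ, State) => S h) e
  simp only [TemperedDistribution.fourier_apply] at e2
  rw [dx, e2]
  have e3 : (fun ξ : ℝ => ((inner ℝ ξ (1 : ℝ) : ℝ) : ℂ)) = fun ξ : ℝ => (ξ : ℂ) := by
    funext ξ; simp
  simp only [mulFreq, FourierTransform.fourier_smul, map_smul]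
  simp [TemperedDistribution.fourier_apply]

lemma iterate_dx_apply_fourier (n : ℕ) (T : 𝓢'(ℝ, State)) (h : 𝓢(ℝ, ℂ)) :
    (dx^[n] T) (𝓕 h) = T (𝓕 (mulFreq^[n] h)) := by
  induction n generalizing h with
  | zero => rfl
  | succ n ih => rw [Function.iterate_succ_apply', dx_apply_fourier, ih, ← Function.iterate_succ_apply]

lemma L2_apply_fourier (f : L2) (h : 𝓢(ℝ, ℂ)) :
    (f : 𝓢'(ℝ, State)) (𝓕 h) = ∫ ξ, h ξ • (𝓕 f : L2) ξ := by
  have e := congrArg (fun S : 𝓢'(ℝ, State) => S h) (Lp.fourier_toTemperedDistribution_eq f)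
  simpa [TemperedDistribution.fourier_apply] using e

lemma integrable_schwartz_smul (h : 𝓢(ℝ, ℂ)) (f : L2) : Integrable fun ξ => h ξ • f ξ :=
  integrable_smul_L2 (h.memLp 2) f

/-- Testing the equation with `𝓕 h` moves the transform onto the unknown and turns derivatives into
powers of `2πiξ`. Freezing time at `0` for negative `s` makes the curve continuous on the whole line
without affecting the equation at positive times. -/
lemma IsSolution.isWeakFourierSolution {k₁ k₂ k₃ k₄ γ : ℝ} {U₀ : L2} {U : ℝ → L2}
    (hU : IsSolution k₁ k₂ k₃ k₄ γ 1 0 0 U₀ U) :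
    IsWeakFourierSolution k₁ k₂ k₃ k₄ γ fun s => 𝓕 (U (max s 0)) := by
  intro t ht h
  have hd := hU.equation t ht (𝓕 h)
  have hval : -(A₂ k₄ (dx (dx (U t : 𝓢'(ℝ, State))) (𝓕 h))
        + A₁ k₁ k₂ k₃ γ 1 0 0 (dx (U t : 𝓢'(ℝ, State)) (𝓕 h))
        + A₀ k₁ ((U t : 𝓢'(ℝ, State)) (𝓕 h))) =
      ∫ ξ, h ξ • symbol k₁ k₂ k₃ k₄ γ (2 * Real.pi * ξ) ((𝓕 (U (max t 0)) : L2) ξ) := by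
    rw [max_eq_left ht.le, dx_apply_fourier, dx_apply_fourier, dx_apply_fourier,
      L2_apply_fourier, L2_apply_fourier, L2_apply_fourier, ← A₂L_apply, ← A₁L_apply, ← A₀L_apply,
      ← ContinuousLinearMap.integral_comp_comm _ (integrable_schwartz_smul _ _),
      ← ContinuousLinearMap.integral_comp_comm _ (integrable_schwartz_smul _ _),
      ← ContinuousLinearMap.integral_comp_comm _ (integrable_schwartz_smul _ _)]
    have i2 := (A₂L k₄).integrable_comp (integrable_schwartz_smul (mulFreq (mulFreq h)) (𝓕 (U t)))
    have i1 := (A₁L k₁ k₂ k₃ γ).integrable_comp (integrable_schwartz_smul (mulFreq h) (𝓕 (U t)))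
    have i0 := (A₀L k₁).integrable_comp (integrable_schwartz_smul h (𝓕 (U t)))
    have i21 : Integrable fun ξ => A₂L k₄ (mulFreq (mulFreq h) ξ • (𝓕 (U t) : L2) ξ) +
        A₁L k₁ k₂ k₃ γ (mulFreq h ξ • (𝓕 (U t) : L2) ξ) := i2.add i1
    rw [← integral_add i2 i1, ← integral_add i21 i0, ← integral_neg]
    congr 1
    funext ξ
    simp only [map_smul, mulFreq_apply, symbol]
    simp only [sub_apply, smul_apply, smul_sub, smul_smul, ← neg_smul, neg_add, Complex.ofReal_mul,
      Complex.ofReal_ofNat]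
    rw [sub_eq_add_neg, sub_eq_add_neg, ← neg_smul, ← neg_smul]
    congr 1
    congr 1
    · congr 1
      ring_nf
      rw [Complex.I_sq]; ring
    · congr 1; ring
  rw [hval] at hd
  refine hd.congr_of_eventuallyEq ?_
  filter_upwards [lt_mem_nhds ht] with s hs
  rw [L2_apply_fourier, max_eq_left hs.le]

lemma IsSolution.continuous_fourier {k₁ k₂ k₃ k₄ γ : ℝ} {U₀ : L2} {U : ℝ → L2}
    (hU : IsSolution k₁ k₂ k₃ k₄ γ 1 0 0 U₀ U) :
    Continuous fun s => (𝓕 (U (max s 0)) : L2) := by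
  have h1 : Continuous fun s : ℝ => U (max s 0) :=
    hU.continuousOn.comp_continuous (by fun_prop) fun s => Set.mem_Ici.2 (le_max_right s 0)
  exact (Lp.fourierTransformₗᵢ ℝ State).continuous.comp h1

lemma iterate_dx_eq_of_fourier_ae {f V : L2} {n : ℕ}
    (h : ∀ᵐ ξ : ℝ, (𝓕 V : L2) ξ = (2 * Real.pi * Complex.I * ξ) ^ n • (𝓕 f : L2) ξ) :
    dx^[n] (f : 𝓢'(ℝ, State)) = (V : 𝓢'(ℝ, State)) := by
  ext1 g
  have hg : g = 𝓕 (𝓕⁻ g) := (FourierTransform.fourier_fourierInv_eq g).symm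
  rw [hg, iterate_dx_apply_fourier, L2_apply_fourier, L2_apply_fourier]
  refine integral_congr_ae ?_
  filter_upwards [h] with ξ h1
  rw [h1, iterate_mulFreq_apply, smul_smul, mul_comm]

lemma exists_schwartz_of_contDiff {g : ℝ → ℝ} (g_smooth : ContDiff ℝ ((⊤ : ℕ∞) : WithTop ℕ∞) g)
    (g_cpt : HasCompactSupport g) : ∃ h : 𝓢(ℝ, ℂ), ∀ ξ, h ξ = (g ξ : ℂ) := by
  have hg₁ : HasCompactSupport (Complex.ofRealCLM ∘ g) := g_cpt.comp_left rfl
  have hg₂ : ContDiff ℝ ((⊤ : ℕ∞) : WithTop ℕ∞) (Complex.ofRealCLM ∘ g) := by fun_prop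
  exact ⟨hg₁.toSchwartzMap hg₂, fun ξ => rfl⟩

lemma fourier_ae_of_iterate_dx_eq {f V : L2} {n : ℕ}
    (h : dx^[n] (f : 𝓢'(ℝ, State)) = (V : 𝓢'(ℝ, State))) :
    ∀ᵐ ξ : ℝ, (𝓕 V : L2) ξ = (2 * Real.pi * Complex.I * ξ) ^ n • (𝓕 f : L2) ξ := by
  apply ae_eq_of_integral_contDiff_smul_eq
  · exact (Lp.memLp _).locallyIntegrable (by norm_num)
  · have := (((Lp.memLp (𝓕 f : L2)).locallyIntegrable (by norm_num)).locallyIntegrableOn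
      Set.univ).continuousOn_smul isOpen_univ.isLocallyClosed
        (g := fun ξ : ℝ => (2 * Real.pi * Complex.I * ξ) ^ n) (by fun_prop)
    exact locallyIntegrableOn_univ.1 this
  · intro g g_smooth g_cpt
    obtain ⟨φ, hφ⟩ := exists_schwartz_of_contDiff g_smooth g_cpt
    have e := congrArg (fun S : 𝓢'(ℝ, State) => S (𝓕 φ)) h
    simp only [iterate_dx_apply_fourier, L2_apply_fourier, iterate_mulFreq_apply, hφ] at e
    simp only [Complex.coe_smul] at e
    rw [← e]
    congr 1
    funext ξ
    rw [mul_comm, mul_smul, Complex.coe_smul]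

/-- The `L²` transform and the integral transform have the same pairings with test functions, so
they agree almost everywhere; the bound is then trivial for the integral. -/
lemma norm_fourier_ae_le_of_integrable {f : L2} (hf : Integrable (f : ℝ → State)) :
    ∀ᵐ ξ : ℝ, ‖(𝓕 f : L2) ξ‖ ≤ ∫ x, ‖f x‖ := by
  have hcont : Continuous (𝓕 (f : ℝ → State) : ℝ → State) :=
    VectorFourier.fourierIntegral_continuous Real.continuous_fourierChar
      (innerSL ℝ).continuous₂ hf
  have h : ∀ᵐ ξ : ℝ, (𝓕 f : L2) ξ = (𝓕 (f : ℝ → State) : ℝ → State) ξ := by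
    apply ae_eq_of_integral_contDiff_smul_eq
    · exact (Lp.memLp _).locallyIntegrable (by norm_num)
    · exact hcont.locallyIntegrable
    · intro g g_smooth g_cpt
      obtain ⟨φ, hφ⟩ := exists_schwartz_of_contDiff g_smooth g_cpt
      have e := L2_apply_fourier f φ
      rw [Lp.toTemperedDistribution_apply] at e
      have e2 := VectorFourier.integral_fourierIntegral_smul_eq_flip (L := innerₗ ℝ)
        Real.continuous_fourierChar (innerSL ℝ).continuous₂ (φ.integrable (μ := volume)) hf
      rw [flip_innerₗ] at e2
      have e3 : ∫ ξ, φ ξ • (𝓕 f : L2) ξ = ∫ ξ, φ ξ • (𝓕 (f : ℝ → State) : ℝ → State) ξ := by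
        rw [← e]; exact e2
      simpa only [hφ, Complex.coe_smul] using e3
  filter_upwards [h] with ξ h1
  rw [h1]
  exact VectorFourier.norm_fourierIntegral_le_integral_norm _ _ _ _ _

lemma MemSobolev.iterate_dx {s : ℝ} {T : 𝓢'(ℝ, State)} (hT : MemSobolev s 2 T) (n : ℕ) :
    MemSobolev (s - n) 2 (dx^[n] T) := by
  induction n with
  | zero => simpa using hT
  | succ n ih =>
    rw [Function.iterate_succ_apply']
    have := ih.lineDerivOp (m := (1 : ℝ))
    rwa [show s - ((n + 1 : ℕ) : ℝ) = s - n - 1 by push_cast; ring]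

lemma exists_iterate_dx_eq {N n : ℕ} (h : n ≤ N) {T : 𝓢'(ℝ, State)}
    (hT : MemSobolev (N : ℝ) 2 T) : ∃ W : L2, dx^[n] T = (W : 𝓢'(ℝ, State)) := by
  have h1 := (MemSobolev.iterate_dx hT n).mono (s' := 0) (by
    rw [sub_nonneg]; exact_mod_cast h)
  exact memSobolev_zero_iff.1 h1

/-! ### The decay estimate -/

/-- One term of the exponential series: `(b x)ⁿ / n! ≤ exp (b x) ≤ exp b * exp (b y)`. -/
lemma exp_neg_le_of_one_add_le {b x y : ℝ} (hb : 0 < b) (hx : 0 < x) (hy : x ≤ 1 + y) (n : ℕ) :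
    Real.exp (-(b * y)) ≤ Real.exp b * (n.factorial / b ^ n) * (x ^ n)⁻¹ := by
  have h1 := Real.pow_div_factorial_le_exp (b * x) (by positivity) n
  have h2 : Real.exp (b * x) ≤ Real.exp b * Real.exp (b * y) := by
    rw [← Real.exp_add]
    exact Real.exp_le_exp.2 (by nlinarith)
  have h3 := h1.trans h2
  rw [div_le_iff₀ (by positivity), mul_pow] at h3
  rw [Real.exp_neg, ← div_eq_mul_inv, mul_div_assoc', le_div_iff₀ (by positivity),
    le_div_iff₀ (by positivity), mul_assoc, inv_mul_le_iff₀ (Real.exp_pos _)]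
  linarith

/-- Splitting into low and high frequencies. -/
lemma exp_rate_le {a : ℝ} (ha : 0 < a) (j ℓ : ℕ) {t ω z m : ℝ} (ht : 0 ≤ t)
    (hz : 0 ≤ z) (hzm : z ≤ m) :
    (ω ^ 2) ^ j * (Real.exp (-(a * rate ω * t)) * z ^ 2) ≤
      Real.exp (a / 16) * (|ω| ^ (2 * j) * Real.exp (-(a / 16 * (1 + t) * |ω| ^ 6))) * m ^ 2 +
      Real.exp (a / 16) * (ℓ.factorial / (a / 16) ^ ℓ) * ((1 + t) ^ ℓ)⁻¹ *
        ((ω ^ 2) ^ (j + ℓ) * z ^ 2) := by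
  rcases le_total (ω ^ 2) 1 with h | h
  -- Low frequencies: `(1 + ω²)⁴ ≤ 16`, and since `ω⁶ ≤ 1` replacing `t` by `1 + t` costs only the
  -- factor `exp (a / 16)`.
  · refine le_add_of_le_of_nonneg ?_ (by positivity)
    have hr : ω ^ 6 / 16 ≤ rate ω := by
      unfold rate
      have h6 : 0 ≤ ω ^ 6 := by positivity
      gcongr
      calc (1 + ω ^ 2) ^ 4 ≤ (1 + 1) ^ 4 := by gcongr
        _ = 16 := by norm_num
    have h6 : ω ^ 6 ≤ 1 := by
      rw [show ω ^ 6 = (ω ^ 2) ^ 3 by ring]; exact pow_le_one₀ (sq_nonneg ω) h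
    have he : Real.exp (-(a * rate ω * t)) ≤
        Real.exp (a / 16) * Real.exp (-(a / 16 * (1 + t) * |ω| ^ 6)) := by
      rw [← Real.exp_add]
      refine Real.exp_le_exp.2 ?_
      rw [show |ω| ^ 6 = ω ^ 6 from Even.pow_abs (by decide) ω]
      have h1 : a * (ω ^ 6 / 16) * t ≤ a * rate ω * t := by gcongr
      nlinarith
    rw [show |ω| ^ (2 * j) = (ω ^ 2) ^ j by rw [pow_mul, sq_abs]]
    calc _ ≤ (ω ^ 2) ^ j * ((Real.exp (a / 16) * Real.exp (-(a / 16 * (1 + t) * |ω| ^ 6)))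
          * m ^ 2) := by gcongr
      _ = _ := by ring
  -- High frequencies: the exponential is traded for `(ω² / (1 + t)) ^ ℓ`, and the factor `ω ^ (2
  -- ℓ)` becomes `ℓ` extra derivatives of the data.
  · refine le_add_of_nonneg_of_le (by positivity) ?_
    have hω : 0 < ω ^ 2 := by linarith
    have hr : 1 / (16 * ω ^ 2) ≤ rate ω := by
      unfold rate
      rw [div_le_div_iff₀ (by positivity) (by positivity)]
      have : (1 + ω ^ 2) ^ 4 ≤ (ω ^ 2 + ω ^ 2) ^ 4 := by gcongr
      calc 1 * (1 + ω ^ 2) ^ 4 ≤ (ω ^ 2 + ω ^ 2) ^ 4 := by linarith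
        _ = ω ^ 6 * (16 * ω ^ 2) := by ring
    have he : Real.exp (-(a * rate ω * t)) ≤
        Real.exp (a / 16) * (ℓ.factorial / (a / 16) ^ ℓ) * (((1 + t) / ω ^ 2) ^ ℓ)⁻¹ := by
      refine le_trans (Real.exp_le_exp.2 ?_) (exp_neg_le_of_one_add_le (b := a / 16)
        (x := (1 + t) / ω ^ 2) (y := t / ω ^ 2) (by positivity) (by positivity) ?_ ℓ)
      · have h1 : a * (1 / (16 * ω ^ 2)) * t ≤ a * rate ω * t := by gcongr
        refine neg_le_neg (le_trans (le_of_eq ?_) h1)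
        field_simp
      · rw [add_div]
        have : 1 / ω ^ 2 ≤ 1 := by rw [div_le_one hω]; exact h
        linarith
    calc _ ≤ (ω ^ 2) ^ j * ((Real.exp (a / 16) * (ℓ.factorial / (a / 16) ^ ℓ) *
          (((1 + t) / ω ^ 2) ^ ℓ)⁻¹) * z ^ 2) := by gcongr
      _ = _ := by
        rw [div_pow (1 + t), inv_div, pow_add]
        ring

/-- A Gamma integral scaling like `s ^ (-(n + 1) / 6)`. With `n = 2 j` and a square root this is the
exponent `-1/12 - j/6`. -/
lemma integral_abs_pow_mul_exp {b : ℝ} (hb : 0 < b) (n : ℕ) :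
    ∃ D : ℝ, 0 < D ∧ ∀ s : ℝ, 0 < s →
      Integrable (fun ξ : ℝ => |2 * Real.pi * ξ| ^ n * Real.exp (-(b * s * |2 * Real.pi * ξ| ^ 6))) ∧
      ∫ ξ : ℝ, |2 * Real.pi * ξ| ^ n * Real.exp (-(b * s * |2 * Real.pi * ξ| ^ 6)) =
        D * s ^ (-((n : ℝ) + 1) / 6) := by
  have hn : (-1 : ℝ) < n := lt_of_lt_of_le (by norm_num) (Nat.cast_nonneg n)
  have hn1 : (0 : ℝ) < (n + 1) / 6 := by positivity
  have hΓ := Real.Gamma_pos_of_pos hn1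
  refine ⟨|(2 * Real.pi)⁻¹| * (2 * (b ^ (-((n : ℝ) + 1) / 6) * (1 / 6) *
    Real.Gamma (((n : ℝ) + 1) / 6))), by positivity, fun s hs => ?_⟩
  have hval : ∫ ξ : ℝ, |2 * Real.pi * ξ| ^ n * Real.exp (-(b * s * |2 * Real.pi * ξ| ^ 6)) =
      |(2 * Real.pi)⁻¹| * (2 * (b ^ (-((n : ℝ) + 1) / 6) * (1 / 6) *
      Real.Gamma (((n : ℝ) + 1) / 6))) * s ^ (-((n : ℝ) + 1) / 6) := by
    rw [Measure.integral_comp_mul_left (fun x : ℝ => |x| ^ n * Real.exp (-(b * s * |x| ^ 6)))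
      (2 * Real.pi), integral_comp_abs (f := fun x => x ^ n * Real.exp (-(b * s * x ^ 6)))]
    have h := integral_rpow_mul_exp_neg_mul_rpow (p := 6) (q := n) (b := b * s) (by norm_num) hn
      (by positivity)
    have e : ∫ x in Set.Ioi (0 : ℝ), x ^ n * Real.exp (-(b * s * x ^ 6)) =
        ∫ x in Set.Ioi (0 : ℝ), x ^ (n : ℝ) * Real.exp (-(b * s) * x ^ (6 : ℝ)) := by
      congr 1; funext x
      rw [Real.rpow_natCast, show (6 : ℝ) = ((6 : ℕ) : ℝ) by norm_num, Real.rpow_natCast, neg_mul]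
    rw [e, h, Real.mul_rpow hb.le hs.le, smul_eq_mul]
    ring
  refine ⟨?_, hval⟩
  -- The integral of a non-integrable function is zero by convention, whereas the computed value is
  -- positive.
  by_contra hni
  rw [integral_undef hni] at hval
  have : 0 < |(2 * Real.pi)⁻¹| * (2 * (b ^ (-((n : ℝ) + 1) / 6) * (1 / 6) *
      Real.Gamma (((n : ℝ) + 1) / 6))) * s ^ (-((n : ℝ) + 1) / 6) := by positivity
  linarith

lemma norm_sq_L2_eq (f : L2) : ‖f‖ ^ 2 = ∫ ξ, ‖f ξ‖ ^ 2 := by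
  have h := re_inner_L2 f f
  simp only [inner_self_eq_norm_sq_to_K] at h
  norm_cast at h

lemma norm_fourier_L2 (f : L2) : ‖(𝓕 f : L2)‖ = ‖f‖ := Lp.norm_fourier_eq f

lemma norm_freq_pow_sq (n : ℕ) (ξ : ℝ) (x : State) :
    ‖(2 * Real.pi * Complex.I * ξ) ^ n • x‖ ^ 2 = ((2 * Real.pi * ξ) ^ 2) ^ n * ‖x‖ ^ 2 := by
  rw [norm_smul, norm_pow, mul_pow, ← pow_mul, mul_comm n 2, pow_mul]
  congr 2
  simp [mul_pow, sq_abs]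

end Laminated

end

/-! ### The decay estimate by Plancherel -/

open Laminated in
theorem theorem3p2 (k₁ k₂ k₃ k₄ γ : ℝ) (hk₁ : 0 < k₁) (hk₂ : 0 < k₂) (hk₃ : 0 < k₃)
    (hk₄ : 0 < k₄) (hγ : 0 < γ) (hne : k₂ ≠ k₃)
    (N ℓ : ℕ) (hℓ : 1 ≤ ℓ) (hℓN : ℓ ≤ N) (j : ℕ) (hj : j ≤ N - ℓ) :
    ∃ c₀ : ℝ, 0 < c₀ ∧
      ∀ U₀ : Laminated.L2,
        MemSobolev (N : ℝ) 2 (U₀ : 𝓢'(ℝ, Laminated.State)) →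
        Integrable (U₀ : ℝ → Laminated.State) →
        ∀ U : ℝ → Laminated.L2,
          Laminated.IsSolution k₁ k₂ k₃ k₄ γ 1 0 0 U₀ U →
          ∀ t : ℝ, 0 ≤ t →
            ∃ V W : Laminated.L2,
              Laminated.dx^[j] (U t : 𝓢'(ℝ, Laminated.State)) = (V : 𝓢'(ℝ, Laminated.State)) ∧
              Laminated.dx^[j + ℓ] (U₀ : 𝓢'(ℝ, Laminated.State)) =
                (W : 𝓢'(ℝ, Laminated.State)) ∧
              ‖V‖ ≤ c₀ * (1 + t) ^ (-(1 / 12 : ℝ) - (j : ℝ) / 6) * (∫ x, ‖U₀ x‖)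
                + c₀ * (1 + t) ^ (-(ℓ : ℝ) / 2) * ‖W‖ := by
  obtain ⟨C, a, hC, ha, hdecay⟩ := exists_fourier_decay hk₁ hk₂ hk₃ hk₄ hγ hne
  obtain ⟨D, hD, hint⟩ := integral_abs_pow_mul_exp (b := a / 16) (by positivity) (2 * j)
  set A := C * Real.exp (a / 16) * D with hA
  set B := C * (Real.exp (a / 16) * (ℓ.factorial / (a / 16) ^ ℓ)) with hB
  have hA0 : 0 < A := by positivity
  have hB0 : 0 < B := by positivity
  -- The estimate is proved for squares with constants `A` and `B`; `1 + A + B` has a square above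
  -- both, which avoids square roots.
  refine ⟨1 + A + B, by positivity, fun U₀ hSob hL1 U hU t ht => ?_⟩
  obtain ⟨W, hW⟩ := exists_iterate_dx_eq (n := j + ℓ) (by omega) hSob
  set m : ℝ := ∫ x, ‖U₀ x‖ with hm
  have hm0 : 0 ≤ m := integral_nonneg fun x => norm_nonneg _
  have hZ := hdecay _ hU.isWeakFourierSolution hU.continuous_fourier t ht
  simp only [max_eq_left ht, max_self, hU.initial] at hZ
  have hmax := norm_fourier_ae_le_of_integrable hL1
  have hWf := fourier_ae_of_iterate_dx_eq hW
  set F : ℝ → Laminated.State := fun ξ =>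
    (2 * Real.pi * Complex.I * ξ) ^ j • (FourierTransform.fourier (U t) : Laminated.L2) ξ with hF
  set G : ℝ → ℝ := fun ξ => C * Real.exp (a / 16) * m ^ 2 * (|2 * Real.pi * ξ| ^ (2 * j) *
      Real.exp (-(a / 16 * (1 + t) * |2 * Real.pi * ξ| ^ 6)))
    + B * ((1 + t) ^ ℓ)⁻¹ * ‖(FourierTransform.fourier W : Laminated.L2) ξ‖ ^ 2 with hG
  have ht1 : 0 < 1 + t := by linarith
  have hFG : ∀ᵐ ξ : ℝ, ‖F ξ‖ ^ 2 ≤ G ξ := by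
    filter_upwards [hZ, hmax, hWf] with ξ h1 h2 h3
    have h4 := exp_rate_le ha j ℓ (ω := 2 * Real.pi * ξ) ht (norm_nonneg _) h2
    rw [hF, hG]
    simp only [h3, norm_freq_pow_sq]
    calc _ ≤ ((2 * Real.pi * ξ) ^ 2) ^ j * (C * Real.exp (-(a * rate (2 * Real.pi * ξ) * t)) *
          ‖(FourierTransform.fourier U₀ : Laminated.L2) ξ‖ ^ 2) := by gcongr
      _ = C * (((2 * Real.pi * ξ) ^ 2) ^ j * (Real.exp (-(a * rate (2 * Real.pi * ξ) * t)) *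
          ‖(FourierTransform.fourier U₀ : Laminated.L2) ξ‖ ^ 2)) := by ring
      _ ≤ _ := mul_le_mul_of_nonneg_left h4 hC.le
      _ = _ := by rw [hB]; ring
  have hGint : Integrable G := ((hint (1 + t) ht1).1.const_mul _).add
    ((integrable_norm_sq_L2 _).const_mul _)
  have hFm : AEStronglyMeasurable F volume :=
    (show Continuous fun ξ : ℝ => (2 * Real.pi * Complex.I * ξ) ^ j by
      fun_prop).aestronglyMeasurable.smul (Lp.memLp _).1
  have hFint : Integrable fun ξ => ‖F ξ‖ ^ 2 := by
    refine hGint.mono' (hFm.norm.pow 2) ?_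
    filter_upwards [hFG] with ξ h
    rwa [Real.norm_of_nonneg (by positivity)]
  -- Square integrability of `∂ₓʲ U(t)` is not assumed: it follows from the integrable majorant `G`,
  -- and the derivative is then defined by Fourier inversion.
  have hFmem : MemLp F 2 volume := (memLp_two_iff_integrable_sq_norm hFm).2 hFint
  set V : Laminated.L2 := FourierTransformInv.fourierInv (hFmem.toLp F) with hV
  have hVF : (FourierTransform.fourier V : Laminated.L2) = hFmem.toLp F :=
    FourierTransform.fourier_fourierInv_eq _
  refine ⟨V, W, ?_, hW, ?_⟩
  · apply iterate_dx_eq_of_fourier_ae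
    rw [hVF]
    exact hFmem.coeFn_toLp
  · set p := (1 + t) ^ (-(1 / 12 : ℝ) - (j : ℝ) / 6) with hp
    set q := (1 + t) ^ (-(ℓ : ℝ) / 2) with hq
    have hp0 : 0 < p := Real.rpow_pos_of_pos ht1 _
    have hq0 : 0 < q := Real.rpow_pos_of_pos ht1 _
    have hpp : (1 + t) ^ (-(((2 * j : ℕ) : ℝ) + 1) / 6) = p ^ 2 := by
      rw [hp, ← Real.rpow_natCast, ← Real.rpow_mul ht1.le]
      congr 1; push_cast; ring
    have hqq : ((1 + t) ^ ℓ)⁻¹ = q ^ 2 := by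
      rw [hq, ← Real.rpow_natCast, ← Real.rpow_natCast, ← Real.rpow_mul ht1.le,
        ← Real.rpow_neg ht1.le]
      congr 1; push_cast; ring
    have hsq : ‖V‖ ^ 2 ≤ A * (p * m) ^ 2 + B * (q * ‖W‖) ^ 2 := by
      rw [← norm_fourier_L2, hVF, norm_sq_L2_eq]
      calc _ = ∫ ξ, ‖F ξ‖ ^ 2 := by
            refine integral_congr_ae ?_
            filter_upwards [hFmem.coeFn_toLp] with ξ h
            rw [h]
        _ ≤ ∫ ξ, G ξ := integral_mono_ae hFint hGint hFG
        _ = _ := by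
          rw [hG, integral_add ((hint (1 + t) ht1).1.const_mul _)
            ((integrable_norm_sq_L2 _).const_mul _), integral_const_mul, integral_const_mul,
            (hint (1 + t) ht1).2, hpp, hqq, ← norm_sq_L2_eq, norm_fourier_L2, hA]
          ring
    have hx : 0 ≤ p * m := by positivity
    have hy : 0 ≤ q * ‖W‖ := by positivity
    have hAA : A ≤ (1 + A + B) ^ 2 := by nlinarith
    have hBB : B ≤ (1 + A + B) ^ 2 := by nlinarith
    rw [mul_assoc, mul_assoc, ← mul_add]
    refine le_of_sq_le_sq ?_ (by positivity)
    calc _ ≤ _ := hsq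
      _ ≤ (1 + A + B) ^ 2 * (p * m) ^ 2 + (1 + A + B) ^ 2 * (q * ‖W‖) ^ 2 := by gcongr
      _ ≤ (1 + A + B) ^ 2 * (p * m + q * ‖W‖) ^ 2 := by
        rw [← mul_add]; gcongr; nlinarith [mul_nonneg hx hy]
      _ = _ := by ring
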